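/- Let $n\ge 1$ and $\alpha>0$. Let $\mu$ be a nonzero finite Borel measure on $\mathbb{R}^n$ that is even (i.e. $\mu(-A)=\mu(A)$ for every Borel set $A$), is not concentrated on any proper linear subspace (i.e. $\mu(\mathbb{R}^n\setminus L)>0$ for every linear subspace $L\subsetneq\mathbb{R}^n$), and has finite first moment $\int_{\mathbb{R}^n}|x|\,d\mu(x)<\infty$. Then there is an upper semi-continuous function $f:\mathbb{R}^n\to[0,\infty)$ such that $\varphi=-\log f:\mathbb{R}^n\to\mathbb{R}\cup\{+\infty\}$ is convex, $0<\int_{\mathbb{R}^n}f\,dx<\infty$, $$\mathcal{I}_\alpha(f):=\int_{\mathbb{R}^n} I_\alpha(f,y)\,f(y)\,dy=\mu(\mathbb{R}^n),\qquad\text{where}\quad I_\alpha(f,y)=\int_{\mathbb{R}^n}\frac{f(x)}{|x-y|^{n-\alpha}}\,dx,$$ and $\mu=\mathfrak{R}_\alpha(f,\cdot)$. Here $\mathfrak{R}_\alpha(f,\cdot)$ is the Riesz $\alpha$-energy measure of $f=e^{-\varphi}$: the push-forward of the measure $I_\alpha(f,y)f(y)\,dy$ on $K_f=\overline{\{x:f(x)>0\}}$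 under the map $\nabla\varphi$, which is defined Lebesgue-almost everywhere on $K_f$. -/

import Mathlib

open MeasureTheory Set
open scoped ENNReal NNReal

noncomputable section

namespace RieszEnergy

/-- `ℝⁿ` with its Euclidean structure. -/
abbrev Rn (n : ℕ) : Type := EuclideanSpace ℝ (Fin n)

variable {n : ℕ}

/-- The function `φ = -log f : ℝⁿ → ℝ ∪ {+∞}` with `f = e^{-φ}`; its value is `+∞` exactly
where `f = 0`, and it never takes the value `-∞` because `f` is finite. -/
def negLog (f : Rn n → ℝ≥0) (x : Rn n) : EReal :=
  -ENNReal.log (f x)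

/-- `f : ℝⁿ → [0, ∞)` is log-concave: `φ = -log f` is convex as a function with values in
`ℝ ∪ {+∞}`. -/
def LogConcave (f : Rn n → ℝ≥0) : Prop :=
  ∀ x y : Rn n, ∀ t : ℝ, 0 ≤ t → t ≤ 1 →
    negLog f (t • x + (1 - t) • y) ≤ (t : EReal) * negLog f x + ((1 - t : ℝ) : EReal) * negLog f y

/-- The class `LC_n`: upper semi-continuous log-concave functions `f : ℝⁿ → [0, ∞)` whose total
mass `∫ f dx` is nonzero and finite. -/
structure MemLC (f : Rn n → ℝ≥0) : Prop where
  logConcave : LogConcave f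
  upperSemicontinuous : UpperSemicontinuous f
  mass_pos : 0 < ∫⁻ x, (f x : ℝ≥0∞)
  mass_lt_top : ∫⁻ x, (f x : ℝ≥0∞) < ∞

/-- `K_f`, the closure of `{x | f x ≠ 0}`. -/
def closedSupport (f : Rn n → ℝ≥0) : Set (Rn n) :=
  closure {x | f x ≠ 0}

/-- The Riesz `α`-potential `I_α(f, y) = ∫ f(x) / |x - y|^{n-α} dx`. -/
def rieszPotential (α : ℝ) (f : Rn n → ℝ≥0) (y : Rn n) : ℝ≥0∞ :=
  ∫⁻ x, (f x : ℝ≥0∞) / ‖x - y‖ₑ ^ ((n : ℝ) - α)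

/-- The Riesz `α`-energy `𝓘_α(f) = ∫ I_α(f, y) f(y) dy`. -/
def rieszEnergy (α : ℝ) (f : Rn n → ℝ≥0) : ℝ≥0∞ :=
  ∫⁻ y, rieszPotential α f y * f y

/-- The gradient `∇φ` of `φ = -log f`. It is meaningful at the points around which `φ` is finite
and at which it is differentiable; for log-concave `f` this is Lebesgue-almost every
point of `K_f`. -/
def gradNegLog (f : Rn n → ℝ≥0) (y : Rn n) : Rn n :=
  gradient (fun x => (negLog f x).toReal) y

/-- The gradient map is Borel measurable, so that push-forwards under it are meaningful. -/
theorem measurable_gradNegLog (f : Rn n → ℝ≥0) : Measurable (gradNegLog f) :=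
  (InnerProductSpace.toDual ℝ (Rn n)).symm.continuous.measurable.comp
    (measurable_fderiv ℝ fun x => (negLog f x).toReal)

/-- The Riesz `α`-energy measure `𝕽_α(f, ·)`: the push-forward under `∇φ` of the measure
`I_α(f, y) f(y) dy` on `K_f`, where `f = e^{-φ}`. -/
def rieszEnergyMeasure (α : ℝ) (f : Rn n → ℝ≥0) : Measure (Rn n) :=
  ((volume.restrict (closedSupport f)).withDensity
    fun y => rieszPotential α f y * f y).map (gradNegLog f)

end RieszEnergy

end

noncomputable section

namespace RieszEnergy

open Filter Topology

variable {n : ℕ}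

/-! ### The Riesz kernel and the energy of an extended nonnegative function -/

/-! Normalize `μ` to a probability measure `P` and maximize `𝓘_α(e^{-ψ*}) exp(-2 ∫ ψ dP)` over even
`ψ ≥ 0` with infimum `0`; the measure equation is the Euler–Lagrange equation of this problem. The
exponent 2 matches the quadratic scaling of the energy, so the functional does not change when a
constant is added to `ψ`. Everything is written multiplicatively, with `E = e^ψ` in `[0, ∞]` and
`expDual E = e^{-ψ*}`, so that infinite values of `ψ` and `ψ*` need no separate treatment; `ψ`
itself need not be convex.

A maximizer exists for three reasons. As `P` has a first moment and charges the complement of every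
proper subspace, `∫ |⟨x, y⟩| dP ≥ c|y|` with `c > 0`, and Fenchel's inequality gives `ψ*(y) ≥ c|y| -
∫ ψ dP`. Together with `ψ* ≥ 0` this bounds the functional by a multiple of `exp(-∫ ψ dP)`, so costs
stay bounded along a maximizing sequence (`Admissible.energy_le`). Energies bounded away from zero
prevent the transforms from collapsing onto a hyperplane (`exists_uniform_lower_bound`).
Log-concavity then turns convergence on a countable dense set into an upper bound everywhere
(`limsup_expDual_le`), while Fatou's lemma controls the cost (`exists_limit`).

For the first variation, replace `ψ` by `ψ + tζ` with `ζ` even, bounded and continuous.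
Near-minimizers in the transform at `y` lie near `∇φ(y)`, where `φ = ψ*`, so `log expDual` has
derivative `ζ(∇φ(y))` at `t = 0+` (`tendsto_logQuotient`). The symmetry of the kernel makes the two
variables contribute equally. Maximality gives one inequality between integrals of `ζ`; applying it
to `-ζ` gives equality. Even test functions determine even measures (`measure_ext_of_even`). -/

/-- The Riesz kernel `z ↦ |z|^{-(n-α)}`. -/
def rieszKernel (α : ℝ) (z : Rn n) : ℝ≥0∞ := (‖z‖ₑ ^ ((n : ℝ) - α))⁻¹

lemma measurable_rieszKernel (α : ℝ) : Measurable (rieszKernel (n := n) α) := by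
  unfold rieszKernel
  fun_prop

lemma rieszKernel_neg (α : ℝ) (z : Rn n) : rieszKernel α (-z) = rieszKernel α z := by
  simp [rieszKernel]

lemma rieszKernel_of_ne_zero (α : ℝ) {z : Rn n} (hz : z ≠ 0) :
    rieszKernel α z = ENNReal.ofReal (‖z‖ ^ (α - n)) := by
  rw [rieszKernel, ← ENNReal.rpow_neg, neg_sub, ← ofReal_norm,
    ENNReal.ofReal_rpow_of_pos (norm_pos_iff.2 hz)]

lemma rieszKernel_ne_zero (α : ℝ) {z : Rn n} (hz : z ≠ 0) : rieszKernel α z ≠ 0 := by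
  rw [rieszKernel_of_ne_zero α hz]
  simpa using Real.rpow_pos_of_pos (norm_pos_iff.2 hz) _

/-- The exponentially decaying function `y ↦ e^{-c|y|}`. -/
def expNegNorm (c : ℝ) (y : Rn n) : ℝ≥0∞ := ENNReal.ofReal (Real.exp (-(c * ‖y‖)))

lemma measurable_expNegNorm (c : ℝ) : Measurable (expNegNorm (n := n) c) := by
  unfold expNegNorm
  fun_prop

lemma one_le_dim [Nontrivial (Rn n)] : 1 ≤ n := by
  rcases Nat.eq_zero_or_pos n with rfl | h
  · exact absurd ‹Nontrivial (Rn 0)› (not_nontrivial _)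
  · exact h

/-- In polar coordinates the Jacobian `r^(n-1)` times `r^(α-n)` is `r^(α-1)`, which is integrable at
`0` exactly because `α > 0`. -/
lemma lintegral_expNegNorm_mul_rieszKernel [Nontrivial (Rn n)] {α c : ℝ} (hα : 0 < α) (hc : 0 < c) :
    ∫⁻ z : Rn n, expNegNorm c z * rieszKernel α z < ∞ := by
  have hn : 1 ≤ n := one_le_dim
  have hint : Integrable (fun z : Rn n => ‖z‖ ^ (α - n) * Real.exp (-(c * ‖z‖))) := by
    rw [integrable_fun_norm_addHaar volume (f := fun r => r ^ (α - n) * Real.exp (-(c * r)))]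
    have h := integrableOn_rpow_mul_exp_neg_mul_rpow (p := 1) (s := α - 1) (b := c)
      (by linarith) one_pos hc
    refine h.congr_fun (fun r hr => ?_) measurableSet_Ioi
    have hr' : (0 : ℝ) < r := hr
    simp only [finrank_euclideanSpace, Fintype.card_fin, smul_eq_mul, Real.rpow_one]
    rw [← mul_assoc, ← Real.rpow_natCast, ← Real.rpow_add hr', Nat.cast_sub hn]
    congr 2
    · push_cast; ring
    · ring
  refine lt_of_eq_of_lt ?_ hint.lintegral_lt_top
  refine lintegral_congr_ae ?_
  have h0 : ∀ᵐ z : Rn n, z ≠ 0 := by simp [ae_iff]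
  filter_upwards [h0] with z hz
  rw [rieszKernel_of_ne_zero α hz, expNegNorm, ← ENNReal.ofReal_mul (Real.exp_pos _).le, mul_comm]

lemma lintegral_expNegNorm [Nontrivial (Rn n)] {c : ℝ} (hc : 0 < c) : ∫⁻ z : Rn n, expNegNorm c z < ∞ := by
  have hn : 1 ≤ n := one_le_dim
  -- For `α = n` the kernel is identically 1.
  have h := lintegral_expNegNorm_mul_rieszKernel (n := n) (α := n) (by exact_mod_cast hn) hc
  simpa [rieszKernel] using h

/-- The double integral `∬ F(x) F(y) |x - y|^{-(n-α)} dx dy`. -/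
def energy (α : ℝ) (F : Rn n → ℝ≥0∞) : ℝ≥0∞ :=
  ∫⁻ p : Rn n × Rn n, F p.1 * F p.2 * rieszKernel α (p.1 - p.2)

lemma measurable_energy_integrand (α : ℝ) {F : Rn n → ℝ≥0∞} (hF : Measurable F) :
    Measurable fun p : Rn n × Rn n => F p.1 * F p.2 * rieszKernel α (p.1 - p.2) :=
  ((hF.comp measurable_fst).mul (hF.comp measurable_snd)).mul
    ((measurable_rieszKernel α).comp (measurable_fst.sub measurable_snd))

lemma energy_mono (α : ℝ) {F G : Rn n → ℝ≥0∞} (h : ∀ x, F x ≤ G x) :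
    energy α F ≤ energy α G :=
  lintegral_mono fun p => mul_le_mul' (mul_le_mul' (h p.1) (h p.2)) le_rfl

lemma energy_const_mul (α : ℝ) (a : ℝ≥0∞) {F : Rn n → ℝ≥0∞} (hF : Measurable F) :
    energy α (fun x => a * F x) = a ^ 2 * energy α F := by
  rw [energy, energy, ← lintegral_const_mul _ (measurable_energy_integrand α hF)]
  refine lintegral_congr fun p => ?_
  ring

/-- The triangle inequality gives `c|x| + c|y| ≥ (c/2)|y| + (c/2)|x - y|`; after this decoupling a
translation factors the double integral into two finite ones. -/
lemma energy_expNegNorm_lt_top [Nontrivial (Rn n)] {α c : ℝ} (hα : 0 < α) (hc : 0 < c) :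
    energy (n := n) α (expNegNorm c) < ∞ := by
  have hc2 : 0 < c / 2 := by linarith
  have hk := measurable_rieszKernel (n := n) α
  have he := measurable_expNegNorm (n := n) (c / 2)
  have hb : energy (n := n) α (expNegNorm c) ≤
      ∫⁻ p : Rn n × Rn n, expNegNorm (c / 2) p.2 *
        (expNegNorm (c / 2) (p.1 - p.2) * rieszKernel α (p.1 - p.2)) := by
    refine lintegral_mono fun p => ?_
    rw [← mul_assoc]
    refine mul_le_mul' ?_ le_rfl
    simp only [expNegNorm]
    rw [← ENNReal.ofReal_mul (Real.exp_pos _).le, ← ENNReal.ofReal_mul (Real.exp_pos _).le,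
      ← Real.exp_add, ← Real.exp_add]
    refine ENNReal.ofReal_le_ofReal (Real.exp_le_exp.2 ?_)
    have := norm_sub_le p.1 p.2
    have h2 := norm_nonneg p.1
    nlinarith
  refine hb.trans_lt ?_
  rw [Measure.volume_eq_prod, lintegral_prod_symm _ (by fun_prop)]
  have : ∀ y : Rn n, ∫⁻ x : Rn n, expNegNorm (c / 2) y *
      (expNegNorm (c / 2) (x - y) * rieszKernel α (x - y)) =
      expNegNorm (c / 2) y * ∫⁻ z : Rn n, expNegNorm (c / 2) z * rieszKernel α z := by
    intro y
    rw [lintegral_const_mul _ (by fun_prop),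
      lintegral_sub_right_eq_self (fun z : Rn n => expNegNorm (c / 2) z * rieszKernel α z) y]
  simp only [this]
  rw [lintegral_mul_const _ he]
  exact ENNReal.mul_lt_top (lintegral_expNegNorm hc2) (lintegral_expNegNorm_mul_rieszKernel hα hc2)

/-- The kernel is nonzero off the diagonal, and the diagonal is null, so `F ⊗ F` must vanish almost
everywhere. -/
lemma lintegral_eq_zero_of_energy_eq_zero [Nontrivial (Rn n)] {α : ℝ} {F : Rn n → ℝ≥0∞}
    (hF : Measurable F) (h : energy α F = 0) : ∫⁻ x, F x = 0 := by
  rw [energy, lintegral_eq_zero_iff (measurable_energy_integrand α hF)] at h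
  have h0 : ∀ᵐ z : Rn n, z ≠ 0 := by simp [ae_iff]
  have h1 : ∀ᵐ p : Rn n × Rn n, p.1 - p.2 ≠ 0 :=
    (quasiMeasurePreserving_sub (volume : Measure (Rn n)) volume).ae h0
  have h2 : ∫⁻ p : Rn n × Rn n, F p.1 * F p.2 = 0 := by
    rw [lintegral_eq_zero_iff (by fun_prop)]
    filter_upwards [h, h1] with p hp hp1
    rcases mul_eq_zero.1 hp with h | h
    · exact h
    · exact absurd h (rieszKernel_ne_zero α hp1)
  rw [Measure.volume_eq_prod, lintegral_prod_mul hF.aemeasurable hF.aemeasurable] at h2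
  simpa using h2

lemma rieszEnergy_eq_energy (α : ℝ) {f : Rn n → ℝ≥0} (hf : Measurable f) :
    rieszEnergy α f = energy α fun x => (f x : ℝ≥0∞) := by
  rw [rieszEnergy, energy, Measure.volume_eq_prod,
    lintegral_prod_symm _ (measurable_energy_integrand α hf.coe_nnreal_ennreal).aemeasurable]
  refine lintegral_congr fun y => ?_
  have hm : Measurable fun x : Rn n => (f x : ℝ≥0∞) / ‖x - y‖ₑ ^ ((n : ℝ) - α) := by fun_prop
  rw [rieszPotential, ← lintegral_mul_const _ hm]
  refine lintegral_congr fun x => ?_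
  rw [rieszKernel, div_eq_mul_inv]
  ring

/-! ### The extended nonnegative exponential and the logarithm -/

/-- The real exponential with values in `[0, ∞]`. -/
def eexp (r : ℝ) : ℝ≥0∞ := ENNReal.ofReal (Real.exp r)

lemma eexp_zero : eexp 0 = 1 := by simp [eexp]

lemma eexp_add (r s : ℝ) : eexp (r + s) = eexp r * eexp s := by
  rw [eexp, Real.exp_add, ENNReal.ofReal_mul (Real.exp_pos _).le, eexp, eexp]

lemma eexp_ne_zero (r : ℝ) : eexp r ≠ 0 := by simp [eexp, Real.exp_pos]

lemma eexp_ne_top (r : ℝ) : eexp r ≠ ∞ := ENNReal.ofReal_ne_top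

lemma eexp_mono {r s : ℝ} (h : r ≤ s) : eexp r ≤ eexp s :=
  ENNReal.ofReal_le_ofReal (Real.exp_le_exp.2 h)

lemma eexp_le_eexp_iff {r s : ℝ} : eexp r ≤ eexp s ↔ r ≤ s := by
  rw [eexp, eexp, ENNReal.ofReal_le_ofReal_iff (Real.exp_pos _).le, Real.exp_le_exp]

lemma eexp_lt_eexp_iff {r s : ℝ} : eexp r < eexp s ↔ r < s := by
  rw [← not_le, eexp_le_eexp_iff, not_le]

lemma eexp_rpow (r t : ℝ) : eexp r ^ t = eexp (r * t) := by
  rw [eexp, ENNReal.ofReal_rpow_of_pos (Real.exp_pos _), ← Real.exp_mul, eexp]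

lemma eexp_mul_eexp_neg (r : ℝ) : eexp r * eexp (-r) = 1 := by
  rw [← eexp_add, add_neg_cancel, eexp_zero]

lemma continuous_eexp : Continuous eexp :=
  ENNReal.continuous_ofReal.comp Real.continuous_exp

lemma exists_eq_eexp {a : ℝ≥0∞} (h0 : a ≠ 0) (h1 : a ≠ ∞) : ∃ r, a = eexp r :=
  ⟨Real.log a.toReal, by
    rw [eexp, Real.exp_log (ENNReal.toReal_pos h0 h1), ENNReal.ofReal_toReal h1]⟩

lemma exists_eq_eexp_of_one_le {a : ℝ≥0∞} (h0 : 1 ≤ a) (h1 : a ≠ ∞) :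
    ∃ r, 0 ≤ r ∧ a = eexp r := by
  obtain ⟨r, rfl⟩ := exists_eq_eexp (zero_lt_one.trans_le h0).ne' h1
  rw [← eexp_zero, eexp_le_eexp_iff] at h0
  exact ⟨r, h0, rfl⟩

lemma le_mul_eexp_iff {a b : ℝ≥0∞} (r : ℝ) : a ≤ b * eexp r ↔ a * eexp (-r) ≤ b := by
  constructor
  · intro h
    calc a * eexp (-r) ≤ b * eexp r * eexp (-r) := by gcongr
      _ = b := by rw [mul_assoc, eexp_mul_eexp_neg, mul_one]
  · intro h
    calc a = a * (eexp r * eexp (-r)) := by rw [eexp_mul_eexp_neg, mul_one]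
      _ = a * eexp (-r) * eexp r := by ring
      _ ≤ b * eexp r := by gcongr

/-- The positive part of the logarithm, with values in `[0, ∞]`. -/
def elog (a : ℝ≥0∞) : ℝ≥0∞ := (ENNReal.log a).toENNReal

lemma elog_eexp (r : ℝ) : elog (eexp r) = ENNReal.ofReal r := by
  rw [elog, eexp, ENNReal.log_ofReal_of_pos (Real.exp_pos _), Real.log_exp]
  simp

lemma elog_top : elog ∞ = ∞ := by simp [elog]

lemma monotone_elog : Monotone elog := fun _ _ h =>
  EReal.toENNReal_le_toENNReal (ENNReal.log_le_log h)

lemma continuous_elog : Continuous elog :=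
  EReal.continuous_toENNReal.comp ENNReal.continuous_log

lemma ofReal_integral_le_lintegral {Ω : Type*} [MeasurableSpace Ω] {P : Measure Ω} {g : Ω → ℝ}
    (hg : Integrable g P) : ENNReal.ofReal (∫ x, g x ∂P) ≤ ∫⁻ x, ENNReal.ofReal (g x) ∂P := by
  refine ENNReal.ofReal_le_of_le_toReal ?_
  rw [integral_eq_lintegral_pos_part_sub_lintegral_neg_part hg]
  exact sub_le_self _ ENNReal.toReal_nonneg

/-! ### The multiplicative Legendre transform -/

/-- For `E = e^ψ` this is `e^{-ψ*}`, with `ψ*` the Legendre transform of `ψ`. -/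
def expDual (E : Rn n → ℝ≥0∞) (y : Rn n) : ℝ≥0∞ := ⨅ x, E x * eexp (-(inner ℝ x y))

lemma expDual_le (E : Rn n → ℝ≥0∞) (x y : Rn n) : expDual E y ≤ E x * eexp (-(inner ℝ x y)) :=
  iInf_le _ x

lemma upperSemicontinuous_expDual (E : Rn n → ℝ≥0∞) : UpperSemicontinuous (expDual E) := by
  refine upperSemicontinuous_iInf fun x => Continuous.upperSemicontinuous ?_
  refine continuous_iff_continuousAt.2 fun y => ?_
  have h : Continuous fun y : Rn n => eexp (-(inner ℝ x y)) := by
    refine continuous_eexp.comp ?_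
    fun_prop
  exact ENNReal.Tendsto.const_mul h.continuousAt (Or.inl (eexp_ne_zero _))

lemma measurable_expDual (E : Rn n → ℝ≥0∞) : Measurable (expDual E) :=
  (upperSemicontinuous_expDual E).measurable

lemma expDual_mono {E G : Rn n → ℝ≥0∞} (h : ∀ x, E x ≤ G x) (y : Rn n) :
    expDual E y ≤ expDual G y :=
  iInf_mono fun x => mul_le_mul' (h x) le_rfl

/-- For each fixed `x` the function under the infimum is log-affine in `y`; hence nothing is assumed
about `E`. -/
lemma expDual_logConcave (E : Rn n → ℝ≥0∞) (y z : Rn n) {t : ℝ} (h0 : 0 ≤ t) (h1 : t ≤ 1) :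
    expDual E y ^ t * expDual E z ^ (1 - t) ≤ expDual E (t • y + (1 - t) • z) := by
  refine le_iInf fun x => ?_
  have h1' : 0 ≤ 1 - t := by linarith
  calc expDual E y ^ t * expDual E z ^ (1 - t)
      ≤ (E x * eexp (-(inner ℝ x y))) ^ t * (E x * eexp (-(inner ℝ x z))) ^ (1 - t) := by
        gcongr
        · exact expDual_le E x y
        · exact expDual_le E x z
    _ = (E x ^ t * E x ^ (1 - t)) * (eexp (-(inner ℝ x y) * t) * eexp (-(inner ℝ x z) * (1 - t))) := by
        rw [ENNReal.mul_rpow_of_nonneg _ _ h0, ENNReal.mul_rpow_of_nonneg _ _ h1', eexp_rpow,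
          eexp_rpow]
        ring
    _ = E x * eexp (-(inner ℝ x (t • y + (1 - t) • z))) := by
        rw [← ENNReal.rpow_add_of_nonneg _ _ h0 h1', ← eexp_add, inner_add_right,
          inner_smul_right, inner_smul_right]
        simp only [add_sub_cancel, ENNReal.rpow_one]
        congr 2
        ring

lemma expDual_const_mul {a : ℝ} (E : Rn n → ℝ≥0∞) (y : Rn n) :
    expDual (fun x => eexp a * E x) y = eexp a * expDual E y := by
  rw [expDual, expDual, ENNReal.mul_iInf_of_ne (eexp_ne_zero a) (eexp_ne_top a)]
  simp only [mul_assoc]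

lemma expDual_neg {E : Rn n → ℝ≥0∞} (hE : ∀ x, E (-x) = E x) (y : Rn n) :
    expDual E (-y) = expDual E y := by
  rw [expDual, expDual, ← (Equiv.neg (Rn n)).iInf_comp]
  simp [hE]

/-- Evenness allows `x` to be replaced by `-x`, whichever gives the smaller exponential. -/
lemma expDual_le_abs {E : Rn n → ℝ≥0∞} (hE : ∀ x, E (-x) = E x) (x y : Rn n) :
    expDual E y ≤ E x * eexp (-|inner ℝ x y|) := by
  rcases abs_cases (inner ℝ x y) with ⟨h, -⟩ | ⟨h, -⟩
  · rw [h]; exact expDual_le E x y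
  · rw [h]
    have := expDual_le E (-x) y
    rwa [hE, inner_neg_left] at this

lemma expDual_le_iInf {E : Rn n → ℝ≥0∞} (hE : ∀ x, E (-x) = E x) (y : Rn n) :
    expDual E y ≤ ⨅ x, E x := by
  refine le_iInf fun x => (expDual_le_abs hE x y).trans ?_
  calc E x * eexp (-|inner ℝ x y|) ≤ E x * eexp 0 := by
        gcongr
        exact eexp_mono (by simp)
    _ = E x := by rw [eexp_zero, mul_one]

lemma expDual_zero (E : Rn n → ℝ≥0∞) : expDual E 0 = ⨅ x, E x := by
  simp [expDual, eexp_zero]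

/-- Superlevel sets of `expDual E` are convex. -/
lemma convex_superlevel_expDual (E : Rn n → ℝ≥0∞) (a : ℝ≥0∞) :
    Convex ℝ {y | a ≤ expDual E y} := by
  intro y hy z hz s t hs ht hst
  obtain rfl : t = 1 - s := by linarith
  refine le_trans ?_ (expDual_logConcave E y z hs (by linarith))
  calc a = a ^ s * a ^ (1 - s) := by
        rw [← ENNReal.rpow_add_of_nonneg _ _ hs ht]; simp
    _ ≤ _ := by gcongr <;> assumption

/-! ### The class of competitors and the decay estimate -/

/-- Even, measurable functions `E = e^ψ` with `inf ψ = 0` and `ψ` integrable. -/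
structure Admissible (P : Measure (Rn n)) (E : Rn n → ℝ≥0∞) : Prop where
  measurable : Measurable E
  even : ∀ x, E (-x) = E x
  iInf_eq : ⨅ x, E x = 1
  lintegral_ne_top : ∫⁻ x, elog (E x) ∂P ≠ ∞

namespace Admissible

variable {P : Measure (Rn n)} {E : Rn n → ℝ≥0∞}

lemma one_le (h : Admissible P E) (x : Rn n) : 1 ≤ E x := h.iInf_eq ▸ iInf_le E x

lemma ae_ne_top (h : Admissible P E) : ∀ᵐ x ∂P, E x ≠ ∞ := by
  filter_upwards [ae_lt_top (continuous_elog.measurable.comp h.measurable) h.lintegral_ne_top]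
    with x hx hx'
  simp [hx', elog_top] at hx

lemma expDual_le_one (h : Admissible P E) (y : Rn n) : expDual E y ≤ 1 :=
  h.iInf_eq ▸ expDual_le_iInf h.even y

lemma expDual_zero (h : Admissible P E) : expDual E 0 = 1 := by
  rw [RieszEnergy.expDual_zero, h.iInf_eq]

/-- Integrating Fenchel's inequality `|⟨x, y⟩| - ψ*(y) ≤ ψ(x)` against `P` bounds `ψ*(y)` below by
`c‖y‖ - ∫ ψ dP`. -/
lemma expDual_le_decay [IsProbabilityMeasure P] (h : Admissible P E) {c : ℝ}
    (hmom : Integrable (fun x : Rn n => ‖x‖) P)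
    (hc : ∀ y : Rn n, c * ‖y‖ ≤ ∫ x, |inner ℝ x y| ∂P) (y : Rn n) :
    expDual E y ≤ eexp ((∫⁻ x, elog (E x) ∂P).toReal - c * ‖y‖) := by
  rcases eq_or_ne (expDual E y) 0 with h0 | h0
  · simp [h0]
  obtain ⟨r, hr⟩ := exists_eq_eexp h0 ((h.expDual_le_one y).trans_lt ENNReal.one_lt_top).ne
  rw [hr]
  have hr0 : r ≤ 0 := by
    have := h.expDual_le_one y
    rwa [hr, ← eexp_zero, eexp_le_eexp_iff] at this
  refine eexp_mono ?_
  set A := ∫⁻ x, elog (E x) ∂P with hA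
  have hpt : ∀ x, ENNReal.ofReal (|inner ℝ x y| + r) ≤ elog (E x) := by
    intro x
    rw [← elog_eexp]
    apply monotone_elog
    have := expDual_le_abs h.even x y
    rw [hr, le_mul_eexp_iff, ← eexp_add, neg_neg] at this
    rwa [add_comm]
  have hint : Integrable (fun x => |inner ℝ x y|) P := by
    refine (hmom.mul_const ‖y‖).mono' (by fun_prop) (ae_of_all _ fun x => ?_)
    simpa using abs_real_inner_le_norm x y
  have h1 : ENNReal.ofReal (∫ x, (|inner ℝ x y| + r) ∂P) ≤ A :=
    (ofReal_integral_le_lintegral (hint.add (integrable_const r))).trans (lintegral_mono hpt)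
  rw [integral_add hint (integrable_const _), integral_const] at h1
  simp only [probReal_univ, one_smul] at h1
  have h2 := ENNReal.toReal_mono h.lintegral_ne_top h1
  have h3 := (le_max_left _ 0).trans_eq
    (ENNReal.toReal_ofReal' (r := ∫ x, |inner ℝ x y| ∂P + r)).symm
  have := hc y
  linarith

end Admissible

/-- By homogeneity it suffices to minimize over the unit sphere. The first moment gives continuity
there, and a zero minimum would concentrate `P` on the hyperplane orthogonal to the minimizer. -/
lemma exists_pos_mul_norm_le_integral_abs_inner [Nontrivial (Rn n)] (P : Measure (Rn n))
    (hmom : Integrable (fun x : Rn n => ‖x‖) P)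
    (hsub : ∀ L : Submodule ℝ (Rn n), L ≠ ⊤ → P (L : Set (Rn n))ᶜ ≠ 0) :
    ∃ c : ℝ, 0 < c ∧ ∀ y : Rn n, c * ‖y‖ ≤ ∫ x, |inner ℝ x y| ∂P := by
  have hcont : ContinuousOn (fun y : Rn n => ∫ x, |inner ℝ x y| ∂P) (Metric.sphere 0 1) := by
    refine continuousOn_of_dominated (bound := fun x => ‖x‖) (fun y _ => ?_) (fun y hy => ?_) hmom
      (ae_of_all _ fun x => ?_)
    · exact Continuous.aestronglyMeasurable (by fun_prop)
    · refine ae_of_all _ fun x => ?_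
      have := abs_real_inner_le_norm x y
      rw [mem_sphere_zero_iff_norm.1 hy, mul_one] at this
      simpa using this
    · exact Continuous.continuousOn (by fun_prop)
  obtain ⟨y₀, hy₀, hmin⟩ := (isCompact_sphere (0 : Rn n) 1).exists_isMinOn
    (NormedSpace.sphere_nonempty.2 zero_le_one) hcont
  have hint : ∀ y : Rn n, Integrable (fun x => |inner ℝ x y|) P := fun y => by
    refine (hmom.mul_const ‖y‖).mono' (by fun_prop) (ae_of_all _ fun x => ?_)
    simpa using abs_real_inner_le_norm x y
  refine ⟨∫ x, |inner ℝ x y₀| ∂P, ?_, fun y => ?_⟩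
  · refine lt_of_le_of_ne (integral_nonneg fun x => abs_nonneg _) fun h0 => ?_
    have hae := (integral_eq_zero_iff_of_nonneg (fun x => abs_nonneg _) (hint y₀)).1 h0.symm
    refine hsub (LinearMap.ker (innerSL ℝ y₀ : Rn n →L[ℝ] ℝ).toLinearMap) (fun htop => ?_) ?_
    · have : y₀ ∈ LinearMap.ker (innerSL ℝ y₀ : Rn n →L[ℝ] ℝ).toLinearMap := htop ▸ trivial
      have h1 : inner ℝ y₀ y₀ = 0 := by simpa using this
      rw [inner_self_eq_zero] at h1
      simp [h1] at hy₀
    · refine measure_mono_null (fun x hx => ?_) hae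
      simp only [mem_compl_iff, SetLike.mem_coe, LinearMap.mem_ker] at hx
      simpa [real_inner_comm] using hx
  · rcases eq_or_ne y 0 with rfl | hy
    · simp
    have hy' : 0 < ‖y‖ := norm_pos_iff.2 hy
    have h1 := hmin (show ‖y‖⁻¹ • y ∈ Metric.sphere (0 : Rn n) 1 by simp [norm_smul, hy'.ne'])
    simp only [mem_ofPred_eq, inner_smul_right, abs_mul, abs_inv, abs_norm, integral_const_mul] at h1
    rwa [inv_mul_eq_div, le_div_iff₀ hy'] at h1

/-- The exponentially decaying majorant of the transforms of competitors. -/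
lemma Admissible.expDual_le_exp {P : Measure (Rn n)} [IsProbabilityMeasure P] {E : Rn n → ℝ≥0∞}
    (h : Admissible P E) {c : ℝ} (hmom : Integrable (fun x : Rn n => ‖x‖) P)
    (hc : ∀ y : Rn n, c * ‖y‖ ≤ ∫ x, |inner ℝ x y| ∂P) (y : Rn n) :
    expDual E y ≤ eexp ((∫⁻ x, elog (E x) ∂P).toReal / 2) * expNegNorm (c / 2) y := by
  have h2 : eexp ((∫⁻ x, elog (E x) ∂P).toReal / 2) * expNegNorm (c / 2) y =
      eexp (((∫⁻ x, elog (E x) ∂P).toReal - c * ‖y‖) / 2) := by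
    rw [expNegNorm, ← eexp, ← eexp_add]
    congr 1
    ring
  rw [h2]
  -- The right-hand side is the geometric mean of the bound `1` and the decay bound, so it is at
  -- least the smaller of the two.
  rcases le_total 0 ((∫⁻ x, elog (E x) ∂P).toReal - c * ‖y‖) with h3 | h3
  · refine (h.expDual_le_one y).trans ?_
    rw [← eexp_zero]
    exact eexp_mono (by linarith)
  · exact (h.expDual_le_decay hmom hc y).trans (eexp_mono (by linarith))

/-- The halved exponent of the majorant leaves only one factor `exp(∫ ψ dP)` after squaring; against
the `exp(-2 ∫ ψ dP)` in `score`, this makes the functional decay as the cost grows. -/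
lemma Admissible.energy_le {P : Measure (Rn n)} [IsProbabilityMeasure P] {E : Rn n → ℝ≥0∞}
    (h : Admissible P E) {c : ℝ} (α : ℝ) (hmom : Integrable (fun x : Rn n => ‖x‖) P)
    (hc : ∀ y : Rn n, c * ‖y‖ ≤ ∫ x, |inner ℝ x y| ∂P) :
    energy α (expDual E) ≤
      eexp ((∫⁻ x, elog (E x) ∂P).toReal) * energy (n := n) α (expNegNorm (c / 2)) := by
  refine (energy_mono α (h.expDual_le_exp hmom hc)).trans_eq ?_
  rw [energy_const_mul _ _ (measurable_expNegNorm _), pow_two, ← eexp_add, add_halves]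

/-- The reference competitor `ψ = |x|`, which shows that the supremum is over a nonempty class; its
cost is the first moment. -/
lemma admissible_eexp_norm {P : Measure (Rn n)} (hmom : Integrable (fun x : Rn n => ‖x‖) P) :
    Admissible P fun x => eexp ‖x‖ where
  measurable := (continuous_eexp.comp continuous_norm).measurable
  even x := by rw [norm_neg]
  iInf_eq := by
    refine le_antisymm ?_ ?_
    · refine (iInf_le _ 0).trans ?_
      rw [norm_zero, eexp_zero]
    · refine le_iInf fun x => ?_
      rw [← eexp_zero]
      exact eexp_mono (norm_nonneg x)
  lintegral_ne_top := by
    simp only [elog_eexp]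
    exact hmom.lintegral_lt_top.ne

/-- The Legendre transform of `|x|` vanishes on the unit ball, so `e^{-ψ*}` is at least 1 there. -/
lemma energy_expDual_eexp_norm_ne_zero [Nontrivial (Rn n)] (α : ℝ) :
    energy α (expDual fun x : Rn n => eexp ‖x‖) ≠ 0 := by
  intro h
  have h0 := lintegral_eq_zero_of_energy_eq_zero (measurable_expDual _) h
  have h1 : volume (Metric.ball (0 : Rn n) 1) ≤ ∫⁻ y, expDual (fun x : Rn n => eexp ‖x‖) y := by
    rw [← lintegral_indicator_one Metric.isOpen_ball.measurableSet]
    refine lintegral_mono fun y => ?_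
    by_cases hy : y ∈ Metric.ball (0 : Rn n) 1
    · simp only [hy, indicator_of_mem, Pi.one_apply]
      refine le_iInf fun x => ?_
      rw [← eexp_add, ← eexp_zero]
      refine eexp_mono ?_
      have h2 := real_inner_le_norm x y
      have h3 := mem_ball_zero_iff.1 hy
      nlinarith [norm_nonneg x]
    · simp [hy]
  rw [h0, nonpos_iff_eq_zero] at h1
  exact (Metric.measure_ball_pos volume (0 : Rn n) one_pos).ne' h1

/-! ### Limits of energies under a common majorant -/

lemma ae_rieszKernel_sub_ne_top [Nontrivial (Rn n)] (α : ℝ) :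
    ∀ᵐ p : Rn n × Rn n, rieszKernel α (p.1 - p.2) ≠ ∞ := by
  have h0 : ∀ᵐ z : Rn n, z ≠ 0 := by simp [ae_iff]
  filter_upwards [(quasiMeasurePreserving_sub (volume : Measure (Rn n)) volume).ae h0] with p hp
  rw [rieszKernel_of_ne_zero α hp]
  exact ENNReal.ofReal_ne_top

lemma tendsto_energy_zero [Nontrivial (Rn n)] {α : ℝ} {f : ℕ → Rn n → ℝ≥0∞} {G : Rn n → ℝ≥0∞}
    (hf : ∀ k, Measurable (f k)) (hfG : ∀ k x, f k x ≤ G x) (hf1 : ∀ k x, f k x ≤ 1)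
    (hG : energy α G ≠ ∞) (hlim : ∀ᵐ x, Tendsto (fun k => f k x) atTop (𝓝 0)) :
    Tendsto (fun k => energy α (f k)) atTop (𝓝 0) := by
  have h := tendsto_lintegral_of_dominated_convergence (μ := volume)
    (F := fun k (p : Rn n × Rn n) => f k p.1 * f k p.2 * rieszKernel α (p.1 - p.2))
    (f := fun _ => 0) (fun p => G p.1 * G p.2 * rieszKernel α (p.1 - p.2))
    (fun k => measurable_energy_integrand α (hf k))
    (fun k => ae_of_all _ fun p => mul_le_mul' (mul_le_mul' (hfG k _) (hfG k _)) le_rfl) hG ?_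
  · simpa [energy] using h
  · have h1 : ∀ᵐ p : Rn n × Rn n, Tendsto (fun k => f k p.1) atTop (𝓝 0) :=
      Measure.quasiMeasurePreserving_fst.ae hlim
    filter_upwards [h1, ae_rieszKernel_sub_ne_top α] with p hp hk
    have h2 : Tendsto (fun k => f k p.1 * rieszKernel α (p.1 - p.2)) atTop (𝓝 0) := by
      simpa using ENNReal.Tendsto.mul_const hp (Or.inr hk)
    refine tendsto_of_tendsto_of_tendsto_of_le_of_le tendsto_const_nhds h2 (fun _ => zero_le)
      fun k => ?_
    simp only
    gcongr
    exact mul_le_of_le_one_right (zero_le) (hf1 k _)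

/-- Reverse Fatou on pairs of points; off the diagonal the kernel is a finite factor and can be
pulled out of the limsup. -/
lemma limsup_energy_le [Nontrivial (Rn n)] {α : ℝ} {f : ℕ → Rn n → ℝ≥0∞} {F G : Rn n → ℝ≥0∞}
    (hf : ∀ k, Measurable (f k)) (hfG : ∀ k x, f k x ≤ G x) (hf1 : ∀ k x, f k x ≤ 1)
    (hG : energy α G ≠ ∞) (hlim : ∀ x, limsup (fun k => f k x) atTop ≤ F x) :
    limsup (fun k => energy α (f k)) atTop ≤ energy α F := by
  refine (limsup_lintegral_le (fun p : Rn n × Rn n => G p.1 * G p.2 * rieszKernel α (p.1 - p.2))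
    (fun k => measurable_energy_integrand α (hf k))
    (fun k => ae_of_all _ fun p => mul_le_mul' (mul_le_mul' (hfG k _) (hfG k _)) le_rfl)
    hG).trans (lintegral_mono_ae ?_)
  have hb : ∀ x, limsup (fun k => f k x) atTop ≠ ∞ := fun x =>
    ((limsup_le_of_le (h := Eventually.of_forall fun k => hf1 k x)).trans_lt
      ENNReal.one_lt_top).ne
  filter_upwards [ae_rieszKernel_sub_ne_top α] with p hk
  simp only [mul_comm _ (rieszKernel α (p.1 - p.2))]
  rw [ENNReal.limsup_const_mul_of_ne_top hk]
  gcongr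
  refine (ENNReal.limsup_mul_le' (Or.inr (hb _)) (Or.inl (hb _))).trans ?_
  exact mul_le_mul' (hlim _) (hlim _)

/-- A convex set symmetric about the origin that misses a point `y` lies in a slab of half-width
`|y|`. -/
lemma exists_slab {s : Set (Rn n)} (hs : Convex ℝ s) (hcl : IsClosed s) (h0 : (0 : Rn n) ∈ s)
    (hneg : ∀ x ∈ s, -x ∈ s) {y : Rn n} (hy : y ∉ s) :
    ∃ θ : Rn n, ‖θ‖ = 1 ∧ ∀ x ∈ s, |inner ℝ θ x| ≤ ‖y‖ := by
  obtain ⟨ℓ, u, hu, huy⟩ := geometric_hahn_banach_closed_point hs hcl hy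
  set w : Rn n := (InnerProductSpace.toDual ℝ (Rn n)).symm ℓ with hw
  have hℓ : ∀ x, ℓ x = inner ℝ w x := fun x => by
    rw [hw, InnerProductSpace.toDual_symm_apply]
  have hu0 : 0 < u := by simpa using hu 0 h0
  have hw0 : 0 < ‖w‖ := by
    refine norm_pos_iff.2 fun h => ?_
    rw [hℓ, h, inner_zero_left] at huy
    linarith
  refine ⟨‖w‖⁻¹ • w, by simp [norm_smul, hw0.ne'], fun x hx => ?_⟩
  rw [inner_smul_left, RCLike.conj_to_real, abs_mul, abs_inv, abs_norm, inv_mul_le_iff₀ hw0]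
  have h1 := hu x hx
  have h2 := hu _ (hneg x hx)
  rw [hℓ] at h1 h2
  rw [hℓ] at huy
  rw [inner_neg_right] at h2
  exact (abs_le.2 ⟨by linarith, by linarith⟩).trans (huy.le.trans (real_inner_le_norm w y))

/-! ### Compactness of sequences of competitors -/

/-- Otherwise superlevel sets at levels tending to zero miss points tending to the origin. Being
convex and symmetric, they lie in slabs of vanishing width; for a subsequence the normals converge,
the transforms tend to zero off one hyperplane, and so do the energies, against `δ > 0`. -/
lemma exists_uniform_lower_bound [Nontrivial (Rn n)] {α : ℝ} {P : Measure (Rn n)}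
    {E : ℕ → Rn n → ℝ≥0∞} (hE : ∀ k, Admissible P (E k)) {G : Rn n → ℝ≥0∞}
    (hG : energy α G ≠ ∞) (hEG : ∀ k y, expDual (E k) y ≤ G y) {δ : ℝ≥0∞} (hδ : 0 < δ)
    (hen : ∀ k, δ ≤ energy α (expDual (E k))) :
    ∃ (e ρ : ℝ), 0 < ρ ∧ ∀ k, ∀ y : Rn n, ‖y‖ ≤ ρ → eexp e ≤ expDual (E k) y := by
  by_contra! hcon
  have hpos : ∀ m : ℕ, (0 : ℝ) < 1 / ((m : ℝ) + 1) := fun m => Nat.one_div_pos_of_nat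
  choose k y hy hlt using fun m : ℕ => hcon (Real.log (1 / ((m : ℝ) + 1))) (1 / (m + 1)) (hpos m)
  have he : ∀ m : ℕ, eexp (Real.log (1 / ((m : ℝ) + 1))) = ENNReal.ofReal (1 / ((m : ℝ) + 1)) :=
    fun m => by rw [eexp, Real.exp_log (hpos m)]
  have hslab : ∀ m : ℕ, ∃ θ : Rn n, ‖θ‖ = 1 ∧
      ∀ x, ENNReal.ofReal (1 / ((m : ℝ) + 1)) ≤ expDual (E (k m)) x →
        |inner ℝ θ x| ≤ 1 / ((m : ℝ) + 1) := by
    intro m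
    -- The transform equals 1 at the origin, above every level `1 / (m + 1)`.
    have h0 : (0 : Rn n) ∈ {x | ENNReal.ofReal (1 / ((m : ℝ) + 1)) ≤ expDual (E (k m)) x} := by
      simp only [mem_ofPred_eq, (hE (k m)).expDual_zero]
      rw [← ENNReal.ofReal_one]
      refine ENNReal.ofReal_le_ofReal ?_
      rw [div_le_one (by positivity)]
      linarith [(Nat.cast_nonneg m : (0 : ℝ) ≤ m)]
    obtain ⟨θ, hθ, h⟩ := exists_slab
      (convex_superlevel_expDual (E (k m)) (ENNReal.ofReal (1 / ((m : ℝ) + 1))))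
      ((upperSemicontinuous_expDual (E (k m))).isClosed_preimage _) h0
      (fun x hx => by simpa only [mem_ofPred_eq, expDual_neg (hE (k m)).even] using hx)
      (y := y m) (by rw [← he]; exact not_le.2 (hlt m))
    exact ⟨θ, hθ, fun x hx => (h x hx).trans (hy m)⟩
  choose θ hθ hθs using hslab
  obtain ⟨θ₀, hθ₀, φ, hφ, hlim⟩ := (isCompact_sphere (0 : Rn n) 1).tendsto_subseq
    (x := θ) fun m => by simpa using hθ m
  have hθ₀' : θ₀ ≠ 0 := by
    rintro rfl
    simp at hθ₀
  have htend : Tendsto (fun m : ℕ => 1 / ((φ m : ℝ) + 1)) atTop (𝓝 0) :=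
    tendsto_one_div_add_atTop_nhds_zero_nat.comp hφ.tendsto_atTop
  have hpt : ∀ᵐ x : Rn n, Tendsto (fun m => expDual (E (k (φ m))) x) atTop (𝓝 0) := by
    have hnull : ∀ᵐ x : Rn n, inner ℝ θ₀ x ≠ 0 := by
      have := Measure.addHaar_submodule (volume : Measure (Rn n))
        (LinearMap.ker (innerSL ℝ θ₀ : Rn n →L[ℝ] ℝ).toLinearMap) (fun htop => ?_)
      · refine measure_mono_null (fun x hx => ?_) this
        simpa using hx
      · have : θ₀ ∈ LinearMap.ker (innerSL ℝ θ₀ : Rn n →L[ℝ] ℝ).toLinearMap := htop ▸ trivial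
        have h1 : inner ℝ θ₀ θ₀ = 0 := by simpa using this
        exact hθ₀' (inner_self_eq_zero.1 h1)
    filter_upwards [hnull] with x hx
    -- Off the limiting hyperplane `|⟨θ, x⟩|` stays away from zero while the slabs shrink, so `x`
    -- eventually leaves the superlevel sets.
    have h1 : Tendsto (fun m => |inner ℝ (θ (φ m)) x|) atTop (𝓝 |inner ℝ θ₀ x|) :=
      (hlim.inner tendsto_const_nhds).abs
    have h2 : Tendsto (fun m : ℕ => ENNReal.ofReal (1 / ((φ m : ℝ) + 1))) atTop (𝓝 0) := by
      simpa only [ENNReal.ofReal_zero] using! (ENNReal.continuous_ofReal.tendsto 0).comp htend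
    refine tendsto_of_tendsto_of_tendsto_of_le_of_le' tendsto_const_nhds h2
      (Eventually.of_forall fun _ => zero_le) ?_
    filter_upwards [htend.eventually_lt h1 (abs_pos.2 hx)] with m hm
    by_contra! hc
    exact absurd (hθs (φ m) x hc.le) (not_le.2 hm)
  have h0 := tendsto_energy_zero (α := α) (fun m => measurable_expDual (E (k (φ m))))
    (fun m => hEG _) (fun m => (hE _).expDual_le_one) hG hpt
  exact absurd (ge_of_tendsto' h0 fun m => hen (k (φ m))) (not_le.2 hδ)

/-- If the bound failed at `y`, choose `r < 1` close to 1 and a dense point `q = r y + (1 - r) z`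
with `‖z‖ ≤ ρ`. Log-concavity and the uniform lower bound at `z` transfer the large values from `y`
to `q`, at a loss that vanishes as `r → 1`; this contradicts the bound at `q` and the semicontinuity
of `F`. -/
lemma limsup_expDual_le {E : ℕ → Rn n → ℝ≥0∞} (h1 : ∀ k y, expDual (E k) y ≤ 1) {e ρ : ℝ}
    (hρ : 0 < ρ) (hlow : ∀ k, ∀ y : Rn n, ‖y‖ ≤ ρ → eexp e ≤ expDual (E k) y)
    {F : Rn n → ℝ≥0∞} (hF : UpperSemicontinuous F)
    (hFq : ∀ j, limsup (fun k => expDual (E k) (TopologicalSpace.denseSeq (Rn n) j)) atTop ≤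
      F (TopologicalSpace.denseSeq (Rn n) j)) (y : Rn n) :
    limsup (fun k => expDual (E k) y) atTop ≤ F y := by
  by_contra! hlt
  obtain ⟨b, hFb, hb⟩ := exists_between hlt
  obtain ⟨b', hbb', hb'⟩ := exists_between hb
  have hb'1 : b' < 1 := hb'.trans_le (limsup_le_of_le (h := Eventually.of_forall fun k => h1 k y))
  obtain ⟨β, rfl⟩ := exists_eq_eexp (bot_le.trans_lt hbb').ne' (hb'1.trans ENNReal.one_lt_top).ne
  have hfreq : ∃ᶠ k in atTop, eexp β < expDual (E k) y := frequently_lt_of_lt_limsup (by isBoundedDefault) hb'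
  have hnear := hF y b hFb
  obtain ⟨U, hU, hUo, hyU⟩ := eventually_nhds_iff.1 hnear
  have hc1 : ContinuousAt (fun r : ℝ => r • y) 1 := by fun_prop
  have hc2 : ContinuousAt (fun r : ℝ => eexp (β * r + e * (1 - r))) 1 :=
    (continuous_eexp.comp (by fun_prop)).continuousAt
  have hev1 : ∀ᶠ r in 𝓝 (1 : ℝ), r • y ∈ U :=
    hc1.eventually_mem (hUo.mem_nhds (by simpa using hyU))
  have hev2 : ∀ᶠ r in 𝓝 (1 : ℝ), b < eexp (β * r + e * (1 - r)) :=
    hc2.eventually_const_lt (by simpa using hbb')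
  have hev3 : ∀ᶠ r in 𝓝[<] (1 : ℝ), 0 < r :=
    nhdsWithin_le_nhds (lt_mem_nhds one_pos)
  obtain ⟨r, ⟨⟨hrU, hrb⟩, hr0⟩, hr1⟩ := ((((hev1.and hev2).filter_mono
    (nhdsWithin_le_nhds (s := Iio 1))).and hev3).and self_mem_nhdsWithin).exists
  have hr1 : r < 1 := hr1
  have h1r : 0 < 1 - r := by linarith
  obtain ⟨j, hjU, hjb⟩ := (TopologicalSpace.denseRange_denseSeq (Rn n)).exists_mem_open
    (hUo.inter (Metric.isOpen_ball (x := r • y) (ε := (1 - r) * ρ)))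
    ⟨r • y, hrU, Metric.mem_ball_self (by positivity)⟩
  set q := TopologicalSpace.denseSeq (Rn n) j with hq
  have hz : ‖(1 - r)⁻¹ • (q - r • y)‖ ≤ ρ := by
    rw [norm_smul, norm_inv, Real.norm_of_nonneg h1r.le, inv_mul_le_iff₀ h1r]
    exact (mem_ball_iff_norm.1 hjb).le
  have hqeq : r • y + (1 - r) • ((1 - r)⁻¹ • (q - r • y)) = q := by
    rw [smul_inv_smul₀ h1r.ne', add_sub_cancel]
  have hfq : ∃ᶠ k in atTop, eexp (β * r + e * (1 - r)) ≤ expDual (E k) q := by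
    refine hfreq.mono fun k hk => ?_
    have h2 := expDual_logConcave (E k) y ((1 - r)⁻¹ • (q - r • y)) hr0.le hr1.le
    rw [hqeq] at h2
    refine le_trans ?_ h2
    rw [eexp_add, ← eexp_rpow, ← eexp_rpow]
    gcongr
    exact hlow k _ hz
  have h3 := (le_limsup_of_frequently_le hfq).trans (hFq j)
  exact absurd ((hrb.trans_le h3).trans (hU q hjU)) (lt_irrefl b)

/-- Sequential compactness: the limit has no larger cost and at least the limiting energy. -/
lemma exists_limit [Nontrivial (Rn n)] {α : ℝ} {P : Measure (Rn n)}
    {E : ℕ → Rn n → ℝ≥0∞} (hE : ∀ k, Admissible P (E k)) {G : Rn n → ℝ≥0∞}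
    (hG : energy α G ≠ ∞) (hEG : ∀ k y, expDual (E k) y ≤ G y) {δ : ℝ≥0∞} (hδ : 0 < δ)
    (hen : ∀ k, δ ≤ energy α (expDual (E k))) {a : ℝ≥0∞} (ha : a ≠ ∞)
    (hcost : Tendsto (fun k => ∫⁻ x, elog (E k x) ∂P) atTop (𝓝 a)) :
    ∃ (F : Rn n → ℝ≥0∞) (φ : ℕ → ℕ), StrictMono φ ∧ Admissible P F ∧ ∫⁻ x, elog (F x) ∂P ≤ a ∧
      limsup (fun k => energy α (expDual (E (φ k)))) atTop ≤ energy α (expDual F) := by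
  set q := TopologicalSpace.denseSeq (Rn n) with hq
  obtain ⟨g, φ, hφ, hg⟩ := CompactSpace.tendsto_subseq fun k (j : ℕ) => expDual (E k) (q j)
  have hg' : ∀ j, Tendsto (fun k => expDual (E (φ k)) (q j)) atTop (𝓝 (g j)) :=
    fun j => (tendsto_pi_nhds.1 hg) j
  have hg1 : ∀ j, g j ≤ 1 := fun j => le_of_tendsto' (hg' j) fun k => (hE _).expDual_le_one _
  obtain ⟨e, ρ, hρ, hlow⟩ := exists_uniform_lower_bound hE hG hEG hδ hen
  -- Additively, the positive part of `sup_j (|⟨x, q_j⟩| - φ_j)` with `φ_j = -log g_j`. It is just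
  -- large enough for its transform to dominate `g j` at `q j`, and small enough to lie below
  -- `liminf E_k`.
  set F : Rn n → ℝ≥0∞ := fun x => 1 ⊔ ⨆ j, g j * eexp |inner ℝ x (q j)| with hF
  have hFm : Measurable F := by
    have hm : ∀ j, Measurable fun x : Rn n => g j * eexp |inner ℝ x (q j)| := fun j =>
      (continuous_eexp.measurable.comp (Continuous.measurable (by fun_prop))).const_mul _
    exact measurable_const.sup (Measurable.iSup hm)
  have hFeven : ∀ x, F (-x) = F x := fun x => by simp [hF]
  have hFinf : ⨅ x, F x = 1 := by
    refine le_antisymm ((iInf_le _ 0).trans ?_) (le_iInf fun x => le_sup_left)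
    simp only [hF, inner_zero_left, abs_zero, eexp_zero, mul_one]
    exact sup_le le_rfl (iSup_le hg1)
  have hFlim : ∀ x, F x ≤ liminf (fun k => E (φ k) x) atTop := by
    intro x
    refine sup_le (le_liminf_of_le (h := Eventually.of_forall fun k => (hE _).one_le x))
      (iSup_le fun j => ?_)
    have h1 : Tendsto (fun k => expDual (E (φ k)) (q j) * eexp |inner ℝ x (q j)|) atTop
        (𝓝 (g j * eexp |inner ℝ x (q j)|)) :=
      ENNReal.Tendsto.mul_const (hg' j) (Or.inr (eexp_ne_top _))
    rw [← h1.liminf_eq]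
    refine liminf_le_liminf (Eventually.of_forall fun k => ?_)
    have h2 := expDual_le_abs (hE (φ k)).even x (q j)
    rw [le_mul_eexp_iff, neg_neg] at h2
    exact h2
  have hFcost : ∫⁻ x, elog (F x) ∂P ≤ a := by
    calc ∫⁻ x, elog (F x) ∂P ≤ ∫⁻ x, liminf (fun k => elog (E (φ k) x)) atTop ∂P := by
          refine lintegral_mono fun x => ?_
          refine (monotone_elog (hFlim x)).trans_eq ?_
          exact monotone_elog.map_liminf_of_continuousAt _ continuous_elog.continuousAt
      _ ≤ liminf (fun k => ∫⁻ x, elog (E (φ k) x) ∂P) atTop :=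
          lintegral_liminf_le fun k => continuous_elog.measurable.comp (hE _).measurable
      _ = a := (hcost.comp hφ.tendsto_atTop).liminf_eq
  refine ⟨F, φ, hφ, ⟨hFm, hFeven, hFinf, (hFcost.trans_lt ha.lt_top).ne⟩, hFcost, ?_⟩
  refine limsup_energy_le (fun k => measurable_expDual _) (fun k => hEG _)
    (fun k => (hE _).expDual_le_one) hG fun y => ?_
  refine limsup_expDual_le (E := fun k => E (φ k)) (fun k => (hE _).expDual_le_one) hρ
    (fun k => hlow _) (upperSemicontinuous_expDual F) (fun j => ?_) y
  refine (hg' j).limsup_eq.trans_le (le_iInf fun x => ?_)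
  calc g j = g j * eexp |inner ℝ x (q j)| * eexp (-|inner ℝ x (q j)|) := by
        rw [mul_assoc, eexp_mul_eexp_neg, mul_one]
    _ ≤ F x * eexp (-(inner ℝ x (q j))) := by
        refine mul_le_mul' ?_ (eexp_mono (neg_le_neg (le_abs_self _)))
        exact (le_iSup (fun j => g j * eexp |inner ℝ x (q j)|) j).trans le_sup_right

/-! ### Existence of a maximizer and the variational inequality -/

/-- The functional to be maximized, `𝓘_α(e^{-ψ*}) exp (-2 ∫ ψ dP)` at `E = e^ψ`. -/
def score (α : ℝ) (P : Measure (Rn n)) (E : Rn n → ℝ≥0∞) : ℝ≥0∞ :=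
  energy α (expDual E) * eexp (-2 * (∫⁻ x, elog (E x) ∂P).toReal)

lemma exists_maximizer [Nontrivial (Rn n)] {α : ℝ} (hα : 0 < α) (P : Measure (Rn n))
    [IsProbabilityMeasure P] (hmom : Integrable (fun x : Rn n => ‖x‖) P) {c : ℝ} (hc : 0 < c)
    (hcP : ∀ y : Rn n, c * ‖y‖ ≤ ∫ x, |inner ℝ x y| ∂P) :
    ∃ E, Admissible P E ∧ energy α (expDual E) ≠ 0 ∧
      ∀ E', Admissible P E' → score α P E' ≤ score α P E := by
  set C₀ := energy (n := n) α (expNegNorm (c / 2)) with hC₀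
  have hC₀top : C₀ ≠ ∞ := (energy_expNegNorm_lt_top hα (by linarith)).ne
  set S : ℝ≥0∞ := ⨆ E : {E // Admissible P E}, score α P E.1 with hS
  have hle : ∀ E, Admissible P E → score α P E ≤ S := fun E hE =>
    le_iSup (fun E : {E // Admissible P E} => score α P E.1) ⟨E, hE⟩
  have hscore : ∀ E, Admissible P E →
      score α P E ≤ C₀ * eexp (-(∫⁻ x, elog (E x) ∂P).toReal) := fun E hE => by
    calc score α P E ≤ _ * C₀ * eexp (-2 * (∫⁻ x, elog (E x) ∂P).toReal) :=
          mul_le_mul' (hE.energy_le α hmom hcP) le_rfl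
      _ = C₀ * (eexp ((∫⁻ x, elog (E x) ∂P).toReal) *
            eexp (-2 * (∫⁻ x, elog (E x) ∂P).toReal)) := by ring
      _ = _ := by
        rw [← eexp_add]
        congr 2
        ring
  have hSC : S ≤ C₀ := iSup_le fun E => (hscore _ E.2).trans <|
    mul_le_of_le_one_right zero_le <| by
      rw [← eexp_zero]
      exact eexp_mono (neg_nonpos.2 ENNReal.toReal_nonneg)
  have hStop : S ≠ ∞ := (hSC.trans_lt hC₀top.lt_top).ne
  have hS0 : S ≠ 0 := fun h0 => by
    have := hle _ (admissible_eexp_norm hmom)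
    rw [h0, nonpos_iff_eq_zero, score, mul_eq_zero] at this
    exact this.elim (energy_expDual_eexp_norm_ne_zero α) (eexp_ne_zero _)
  have hS2 : S / 2 ≠ 0 := by simp [hS0]
  -- Starting the sequence above `S / 2` gives the energies the positive lower bound needed for
  -- compactness: energy dominates score because costs are nonnegative.
  obtain ⟨u, -, hu, hulim⟩ := exists_seq_strictMono_tendsto' (ENNReal.half_lt_self hS0 hStop)
  have hex : ∀ k, ∃ E, Admissible P E ∧ u k < score α P E := fun k => by
    obtain ⟨E, hE⟩ := lt_iSup_iff.1 (hu k).2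
    exact ⟨E.1, E.2, hE⟩
  choose E hE huE using hex
  obtain ⟨γ, hγ⟩ := exists_eq_eexp (fun h => hS0 (le_zero_iff.1 (h ▸ hSC))) hC₀top
  obtain ⟨σ, hσ⟩ := exists_eq_eexp hS2 ((ENNReal.half_lt_self hS0 hStop).trans_le le_top).ne
  set A : ℕ → ℝ := fun k => (∫⁻ x, elog (E k x) ∂P).toReal with hA
  have hA0 : ∀ k, 0 ≤ A k := fun k => ENNReal.toReal_nonneg
  -- From `S / 2 < score ≤ C₀ exp(-A k)`, with `C₀ = e^γ` and `S / 2 = e^σ`.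
  have hAB : ∀ k, A k ≤ γ - σ := fun k => by
    have h1 : eexp σ ≤ eexp (γ + -A k) := by
      rw [eexp_add, ← hγ, ← hσ]
      exact ((hu k).1.trans (huE k)).le.trans (hscore _ (hE k))
    rw [eexp_le_eexp_iff] at h1
    linarith
  obtain ⟨a, ha, φ, hφ, hφlim⟩ := (isCompact_Icc (a := (0 : ℝ)) (b := γ - σ)).tendsto_subseq
    (x := A) fun k => ⟨hA0 k, hAB k⟩
  have hcost : Tendsto (fun k => ∫⁻ x, elog (E (φ k) x) ∂P) atTop (𝓝 (ENNReal.ofReal a)) := by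
    refine ((ENNReal.continuous_ofReal.tendsto a).comp hφlim).congr fun k => ?_
    exact ENNReal.ofReal_toReal (hE _).lintegral_ne_top
  obtain ⟨F, χ, hχ, hF, hFa, hlim⟩ := exists_limit (E := fun k => E (φ k)) (fun k => hE _)
    (α := α) (G := fun y => eexp ((γ - σ) / 2) * expNegNorm (c / 2) y) (δ := S / 2)
    (by
      rw [energy_const_mul _ _ (measurable_expNegNorm _)]
      exact ENNReal.mul_ne_top (ENNReal.pow_ne_top (eexp_ne_top _)) hC₀top)
    (fun k y => ((hE _).expDual_le_exp hmom hcP y).trans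
      (mul_le_mul' (eexp_mono (by linarith [hAB (φ k)])) le_rfl))
    (pos_iff_ne_zero.2 hS2)
    (fun k => ((hu _).1.trans (huE _)).le.trans <| mul_le_of_le_one_right zero_le <| by
      rw [← eexp_zero]
      exact eexp_mono (by linarith [hA0 (φ k)]))
    ENNReal.ofReal_ne_top hcost
  have h1 : Tendsto (fun k => u (φ (χ k)) * eexp (2 * A (φ (χ k)))) atTop (𝓝 (S * eexp (2 * a))) := by
    refine ENNReal.Tendsto.mul
      (hulim.comp (hφ.tendsto_atTop.comp hχ.tendsto_atTop)) (Or.inl hS0) ?_ (Or.inr hStop)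
    refine (continuous_eexp.tendsto _).comp ?_
    exact (hφlim.comp hχ.tendsto_atTop).const_mul 2
  have h2 : S * eexp (2 * a) ≤ energy α (expDual F) := by
    rw [← h1.limsup_eq]
    refine le_trans (limsup_le_limsup (Eventually.of_forall fun k => ?_)) hlim
    have h3 := (huE (φ (χ k))).le
    rw [score, le_mul_eexp_iff] at h3
    rwa [neg_mul, neg_neg] at h3
  have h3 : S ≤ score α P F := by
    rw [score, le_mul_eexp_iff]
    refine le_trans (mul_le_mul' le_rfl (eexp_mono ?_)) h2
    have := ENNReal.toReal_mono ENNReal.ofReal_ne_top hFa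
    rw [ENNReal.toReal_ofReal ha.1] at this
    linarith
  refine ⟨F, hF, fun h0 => ?_, fun E' hE' => (hle E' hE').trans h3⟩
  rw [h0, nonpos_iff_eq_zero, mul_eq_zero] at h2
  exact h2.elim hS0 (eexp_ne_zero _)

/-- Adding `ζ` may spoil `inf ψ = 0`; subtracting `m = inf (ψ + ζ)`, finite since `ζ` is bounded,
restores it and lowers the cost by `m`. -/
lemma Admissible.perturb {P : Measure (Rn n)} [IsProbabilityMeasure P] {E : Rn n → ℝ≥0∞}
    (hE : Admissible P E) {ζ : Rn n → ℝ} (hζ : Continuous ζ) (heven : ∀ x, ζ (-x) = ζ x) {M : ℝ}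
    (hM : ∀ x, |ζ x| ≤ M) :
    ∃ m : ℝ, Admissible P (fun x => eexp (-m) * (E x * eexp (ζ x))) ∧
      (∫⁻ x, elog (eexp (-m) * (E x * eexp (ζ x))) ∂P).toReal =
        (∫⁻ x, elog (E x) ∂P).toReal + ∫ x, ζ x ∂P - m := by
  have hm0 : ⨅ x, E x * eexp (ζ x) ≠ 0 := by
    refine ne_of_gt (lt_of_lt_of_le (pos_iff_ne_zero.2 (eexp_ne_zero (-M))) (le_iInf fun x => ?_))
    calc eexp (-M) = 1 * eexp (-M) := (one_mul _).symm
      _ ≤ _ := mul_le_mul' (hE.one_le x) (eexp_mono (neg_le_of_abs_le (hM x)))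
  have hm1 : ⨅ x, E x * eexp (ζ x) ≠ ∞ := by
    refine ne_top_of_le_ne_top (eexp_ne_top M) ?_
    calc ⨅ x, E x * eexp (ζ x) ≤ ⨅ x, eexp M * E x := iInf_mono fun x => by
          rw [mul_comm]
          exact mul_le_mul' (eexp_mono (le_of_abs_le (hM x))) le_rfl
      _ = eexp M := by
          rw [← ENNReal.mul_iInf_of_ne (eexp_ne_zero M) (eexp_ne_top M), hE.iInf_eq, mul_one]
  obtain ⟨m, hm⟩ := exists_eq_eexp hm0 hm1
  have hinf : ⨅ x, eexp (-m) * (E x * eexp (ζ x)) = 1 := by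
    rw [← ENNReal.mul_iInf_of_ne (eexp_ne_zero _) (eexp_ne_top _), hm, mul_comm, eexp_mul_eexp_neg]
  have hmeas : Measurable fun x => elog (E x) := continuous_elog.measurable.comp hE.measurable
  have hint : Integrable (fun x => (elog (E x)).toReal) P :=
    integrable_toReal_of_lintegral_ne_top hmeas.aemeasurable hE.lintegral_ne_top
  have hζi : Integrable ζ P :=
    (integrable_const M).mono' hζ.aestronglyMeasurable (ae_of_all _ fun x => by simpa using hM x)
  have hpt : ∀ᵐ x ∂P, elog (eexp (-m) * (E x * eexp (ζ x))) =
      ENNReal.ofReal ((elog (E x)).toReal + ζ x - m) ∧ 0 ≤ (elog (E x)).toReal + ζ x - m := by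
    filter_upwards [hE.ae_ne_top] with x hx
    obtain ⟨r, hr0, hr⟩ := exists_eq_eexp_of_one_le (hE.one_le x) hx
    have h1 : (1 : ℝ≥0∞) ≤ eexp (-m) * (E x * eexp (ζ x)) := hinf ▸ iInf_le _ x
    rw [hr, elog_eexp, ENNReal.toReal_ofReal hr0]
    rw [hr, ← eexp_add, ← eexp_add, ← eexp_zero, eexp_le_eexp_iff] at h1
    rw [← eexp_add, ← eexp_add, elog_eexp]
    exact ⟨by congr 1; ring, by linarith⟩
  have hint' : Integrable (fun x => (elog (E x)).toReal + ζ x - m) P :=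
    (hint.add hζi).sub (integrable_const m)
  have hI : ∫ x, ((elog (E x)).toReal + ζ x - m) ∂P =
      (∫⁻ x, elog (E x) ∂P).toReal + ∫ x, ζ x ∂P - m := by
    rw [integral_sub (by exact hint.add hζi) (integrable_const m), integral_add hint hζi,
      integral_toReal hmeas.aemeasurable (ae_lt_top hmeas hE.lintegral_ne_top)]
    simp
  have hcost : ∫⁻ x, elog (eexp (-m) * (E x * eexp (ζ x))) ∂P =
      ENNReal.ofReal ((∫⁻ x, elog (E x) ∂P).toReal + ∫ x, ζ x ∂P - m) := by
    rw [lintegral_congr_ae (hpt.mono fun x hx => hx.1),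
      ← ofReal_integral_eq_lintegral_ofReal hint' (hpt.mono fun x hx => hx.2), hI]
  refine ⟨m, ⟨?_, fun x => by rw [hE.even, heven], hinf, hcost ▸ ENNReal.ofReal_ne_top⟩, ?_⟩
  · exact (hE.measurable.mul (continuous_eexp.comp hζ).measurable).const_mul _
  · rw [hcost, ENNReal.toReal_ofReal]
    rw [← hI]
    exact integral_nonneg_of_ae (hpt.mono fun x hx => hx.2)

/-- The normalizing constant `m` cancels: it multiplies the energy by `e^{-2m}` and the cost factor
by `e^{2m}`. -/
lemma energy_perturb_le {α : ℝ} {P : Measure (Rn n)} [IsProbabilityMeasure P] {E : Rn n → ℝ≥0∞}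
    (hE : Admissible P E) (hmax : ∀ E', Admissible P E' → score α P E' ≤ score α P E)
    {ζ : Rn n → ℝ} (hζ : Continuous ζ) (heven : ∀ x, ζ (-x) = ζ x) {M : ℝ} (hM : ∀ x, |ζ x| ≤ M) :
    energy α (expDual fun x => E x * eexp (ζ x)) ≤
      energy α (expDual E) * eexp (2 * ∫ x, ζ x ∂P) := by
  obtain ⟨m, hadm, hcost⟩ := hE.perturb hζ heven hM
  have h := hmax _ hadm
  rw [score, score, hcost, funext (expDual_const_mul _),
    energy_const_mul _ _ (measurable_expDual _), le_mul_eexp_iff] at h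
  rw [le_mul_eexp_iff]
  refine le_trans (le_of_eq ?_) h
  set I := energy α (expDual fun x => E x * eexp (ζ x))
  rw [pow_two, ← eexp_add, mul_comm _ I, mul_assoc, mul_assoc, ← eexp_add, ← eexp_add]
  congr 2
  ring

/-- Existence of an extremal function with prescribed energy, and its variational inequality. -/
lemma exists_extremal [Nontrivial (Rn n)] {α : ℝ} (hα : 0 < α) (P : Measure (Rn n))
    [IsProbabilityMeasure P] (hmom : Integrable (fun x : Rn n => ‖x‖) P)
    (hsub : ∀ L : Submodule ℝ (Rn n), L ≠ ⊤ → P (L : Set (Rn n))ᶜ ≠ 0) {m : ℝ≥0∞} (hm0 : m ≠ 0)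
    (hm : m ≠ ∞) :
    ∃ E : Rn n → ℝ≥0∞, (∀ x, E (-x) = E x) ∧ energy α (expDual E) = m ∧
      (∃ b c : ℝ, 0 < c ∧ ∀ y, expDual E y ≤ eexp b * expNegNorm c y) ∧
      ∀ ζ : Rn n → ℝ, Continuous ζ → (∀ x, ζ (-x) = ζ x) → (∃ M, ∀ x, |ζ x| ≤ M) →
        energy α (expDual fun x => E x * eexp (ζ x)) ≤ m * eexp (2 * ∫ x, ζ x ∂P) := by
  obtain ⟨c, hc, hcP⟩ := exists_pos_mul_norm_le_integral_abs_inner P hmom hsub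
  obtain ⟨E, hE, hE0, hmax⟩ := exists_maximizer hα P hmom hc hcP
  have hEtop : energy α (expDual E) ≠ ∞ := ne_top_of_le_ne_top
    (ENNReal.mul_ne_top (eexp_ne_top _) (energy_expNegNorm_lt_top hα (by linarith)).ne)
    (hE.energy_le α hmom hcP)
  obtain ⟨i, hi⟩ := exists_eq_eexp hE0 hEtop
  obtain ⟨r, rfl⟩ := exists_eq_eexp hm0 hm
  -- The energy is homogeneous of degree 2, so scaling by `e^s` turns `e^i` into `e^r`.
  set s := (r - i) / 2 with hs
  have hsq : eexp s ^ 2 * eexp i = eexp r := by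
    rw [pow_two, ← eexp_add, ← eexp_add]
    congr 1
    ring
  refine ⟨fun x => eexp s * E x, fun x => by simp only [hE.even], ?_,
    ⟨s + (∫⁻ x, elog (E x) ∂P).toReal / 2, c / 2, by linarith, fun y => ?_⟩, ?_⟩
  · rw [funext (expDual_const_mul _), energy_const_mul _ _ (measurable_expDual _), hi, hsq]
  · rw [expDual_const_mul, eexp_add, mul_assoc]
    exact mul_le_mul' le_rfl (hE.expDual_le_exp hmom hcP y)
  · rintro ζ hζ heven ⟨M, hM⟩
    have h := energy_perturb_le hE hmax hζ heven hM
    simp only [mul_assoc]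
    rw [funext (expDual_const_mul _), energy_const_mul _ _ (measurable_expDual _), ← hsq,
      mul_assoc, ← hi]
    exact mul_le_mul' le_rfl h

/-! ### Regularity of the potential `φ = -log f` -/

lemma log_eexp (r : ℝ) : ENNReal.log (eexp r) = r := by
  rw [eexp, ENNReal.log_ofReal_of_pos (Real.exp_pos _), Real.log_exp]

lemma toReal_negLog_of_eq_eexp {f : Rn n → ℝ≥0} {y : Rn n} {r : ℝ} (h : (f y : ℝ≥0∞) = eexp r) :
    (negLog f y).toReal = -r := by
  rw [negLog, h, log_eexp, ← EReal.coe_neg, EReal.toReal_coe]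

lemma coe_eq_eexp {f : Rn n → ℝ≥0} {y : Rn n} (h : f y ≠ 0) :
    (f y : ℝ≥0∞) = eexp (-(negLog f y).toReal) := by
  obtain ⟨r, hr⟩ := exists_eq_eexp (ENNReal.coe_ne_zero.2 h) ENNReal.coe_ne_top
  rw [toReal_negLog_of_eq_eexp hr, neg_neg, hr]

lemma logConcave_of_coe_eq_expDual {f : Rn n → ℝ≥0} {E : Rn n → ℝ≥0∞}
    (hfE : ∀ y, (f y : ℝ≥0∞) = expDual E y) : LogConcave f := by
  intro x y t h0 h1
  have h := expDual_logConcave E x y h0 h1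
  simp only [← hfE] at h
  have h' := ENNReal.log_le_log h
  rw [ENNReal.log_mul_add] at h'
  have hx : ENNReal.log ((f x : ℝ≥0∞) ^ t) ≠ ⊤ := by
    rw [Ne, ENNReal.log_eq_top_iff]
    exact ENNReal.rpow_ne_top_of_nonneg h0 ENNReal.coe_ne_top
  have hy : ENNReal.log ((f y : ℝ≥0∞) ^ (1 - t)) ≠ ⊤ := by
    rw [Ne, ENNReal.log_eq_top_iff]
    exact ENNReal.rpow_ne_top_of_nonneg (by linarith) ENNReal.coe_ne_top
  have h2 := EReal.neg_le_neg_iff.2 h'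
  rw [EReal.neg_add (Or.inr hy) (Or.inl hx), ENNReal.log_rpow, ENNReal.log_rpow] at h2
  simpa only [negLog, mul_neg, sub_eq_add_neg] using h2

lemma convexOn_toReal_negLog {f : Rn n → ℝ≥0} {E : Rn n → ℝ≥0∞}
    (hfE : ∀ y, (f y : ℝ≥0∞) = expDual E y) :
    ConvexOn ℝ {y | f y ≠ 0} fun y => (negLog f y).toReal := by
  have key : ∀ y z : Rn n, f y ≠ 0 → f z ≠ 0 → ∀ t : ℝ, 0 ≤ t → t ≤ 1 →
      eexp (-(t * (negLog f y).toReal + (1 - t) * (negLog f z).toReal)) ≤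
        f (t • y + (1 - t) • z) := by
    intro y z hy hz t h0 h1
    have h := expDual_logConcave E y z h0 h1
    rw [← hfE, ← hfE, ← hfE, coe_eq_eexp hy, coe_eq_eexp hz, eexp_rpow, eexp_rpow,
      ← eexp_add] at h
    refine le_trans (eexp_mono (le_of_eq ?_)) h
    ring
  have hne : ∀ y z : Rn n, f y ≠ 0 → f z ≠ 0 → ∀ t : ℝ, 0 ≤ t → t ≤ 1 →
      f (t • y + (1 - t) • z) ≠ 0 := fun y z hy hz t h0 h1 h => by
    have := key y z hy hz t h0 h1
    rw [h, ENNReal.coe_zero, nonpos_iff_eq_zero] at this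
    exact eexp_ne_zero _ this
  refine ⟨fun y hy z hz s t hs ht hst => ?_, fun y hy z hz s t hs ht hst => ?_⟩
  · obtain rfl : t = 1 - s := by linarith
    exact hne y z hy hz s hs (by linarith)
  · obtain rfl : t = 1 - s := by linarith
    have h := key y z hy hz s hs (by linarith)
    rw [coe_eq_eexp (hne y z hy hz s hs (by linarith)), eexp_le_eexp_iff] at h
    simpa using neg_le_neg_iff.1 h

/-- A convex function is differentiable almost everywhere in the interior of its domain. -/
lemma ae_differentiableAt_of_convexOn {s : Set (Rn n)} {φ : Rn n → ℝ} (h : ConvexOn ℝ s φ) :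
    ∀ᵐ y, y ∈ interior s → DifferentiableAt ℝ φ y := by
  set B := {y | ¬(y ∈ interior s → DifferentiableAt ℝ φ y)} with hB
  refine measure_null_of_locally_null B fun y hy => ?_
  have hyB : y ∈ interior s ∧ ¬DifferentiableAt ℝ φ y := by simpa [hB] using hy
  obtain ⟨K, t, ht, hK⟩ := h.locallyLipschitzOn_interior hyB.1
  rw [isOpen_interior.nhdsWithin_eq hyB.1] at ht
  refine ⟨B ∩ interior t, inter_mem self_mem_nhdsWithin
    (mem_nhdsWithin_of_mem_nhds (interior_mem_nhds.2 ht)), ?_⟩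
  have hae := (hK.mono interior_subset).ae_differentiableWithinAt_of_mem (μ := volume)
  refine measure_mono_null (fun z hz => ?_) hae
  have hzB : z ∈ interior s ∧ ¬DifferentiableAt ℝ φ z := by simpa [hB] using hz.1
  exact fun hcon => hzB.2 ((hcon hz.2).differentiableAt (isOpen_interior.mem_nhds hz.2))

/-- The domain `{f ≠ 0}` is convex, so its boundary is null; in the interior a convex function is
locally Lipschitz and Rademacher's theorem applies. -/
lemma ae_differentiableAt_negLog {f : Rn n → ℝ≥0} {E : Rn n → ℝ≥0∞}
    (hfE : ∀ y, (f y : ℝ≥0∞) = expDual E y) :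
    ∀ᵐ y, f y ≠ 0 → (∀ᶠ z in 𝓝 y, f z ≠ 0) ∧
      HasGradientAt (fun x => (negLog f x).toReal) (gradNegLog f y) y := by
  have hconv := convexOn_toReal_negLog hfE
  have hfr : ∀ᵐ y : Rn n, y ∉ frontier {y | f y ≠ 0} :=
    measure_eq_zero_iff_ae_notMem.1 (hconv.1.addHaar_frontier volume)
  filter_upwards [ae_differentiableAt_of_convexOn hconv, hfr] with y hy hfy h0
  have hint : y ∈ interior {y | f y ≠ 0} := by
    by_contra hc
    exact hfy ⟨subset_closure h0, hc⟩
  exact ⟨mem_interior_iff_mem_nhds.1 hint, (hy hint).hasGradientAt⟩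

/-! ### Differentiating the transform -/

/-- Near-minimizers in the definition of `expDual E y` are close to the gradient at `y`. -/
lemma near_minimizers_close {f : Rn n → ℝ≥0} {E : Rn n → ℝ≥0∞}
    (hfE : ∀ y, (f y : ℝ≥0∞) = expDual E y) {y p : Rn n} (hy : ∀ᶠ z in 𝓝 y, f z ≠ 0)
    (hp : HasGradientAt (fun x => (negLog f x).toReal) p y) {ε : ℝ} (hε : 0 < ε) :
    ∃ δ > 0, ∀ x, E x * eexp (-(inner ℝ x y)) ≤ f y * eexp δ → ‖x - p‖ < ε := by
  have hev := (hasGradientAt_iff_isLittleO.1 hp).def (show (0 : ℝ) < ε / 3 by linarith)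
  obtain ⟨r, hr, hball⟩ := Metric.eventually_nhds_iff.1 (hev.and hy)
  -- Test at the point `z` at distance `r / 2` from `y` in the direction of `x - p`. Fenchel's
  -- inequality at `z`, the first-order expansion of `φ` (error `ε / 3 * (r / 2)`) and
  -- near-minimality give `(r / 2)‖x - p‖ ≤ 2 (ε / 3)(r / 2)`, impossible if `‖x - p‖ ≥ ε`.
  refine ⟨ε / 3 * (r / 2), by positivity, fun x hx => ?_⟩
  by_contra! hcon
  have hxp : 0 < ‖x - p‖ := hε.trans_le hcon
  set z := y + (r / 2) • (‖x - p‖⁻¹ • (x - p)) with hz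
  have hzy : z - y = (r / 2) • (‖x - p‖⁻¹ • (x - p)) := by rw [hz, add_sub_cancel_left]
  have hnorm : ‖z - y‖ = r / 2 := by
    rw [hzy, norm_smul, norm_smul, norm_inv, norm_norm, inv_mul_cancel₀ hxp.ne', mul_one,
      Real.norm_of_nonneg (by positivity)]
  have hin : inner ℝ (x - p) (z - y) = r / 2 * ‖x - p‖ := by
    rw [hzy, inner_smul_right, inner_smul_right, real_inner_self_eq_norm_sq]
    field_simp
  obtain ⟨h1, hfz⟩ := hball (y := z) (by rw [dist_eq_norm, hnorm]; linarith)
  have hfy : f y ≠ 0 := hy.self_of_nhds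
  have hE0 : E x ≠ 0 := fun h => by
    have := expDual_le E x y
    rw [← hfE, h, zero_mul, nonpos_iff_eq_zero, ENNReal.coe_eq_zero] at this
    exact hfy this
  have hE1 : E x ≠ ∞ := fun h => by
    rw [h, ENNReal.top_mul (eexp_ne_zero _), top_le_iff] at hx
    exact ENNReal.mul_ne_top ENNReal.coe_ne_top (eexp_ne_top _) hx
  obtain ⟨e, he⟩ := exists_eq_eexp hE0 hE1
  have h2 := expDual_le E x z
  rw [← hfE, he, coe_eq_eexp hfz, ← eexp_add, eexp_le_eexp_iff] at h2
  rw [he, coe_eq_eexp hfy, ← eexp_add, ← eexp_add, eexp_le_eexp_iff] at hx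
  rw [hnorm] at h1
  have h3 := le_of_abs_le h1
  rw [inner_sub_left, inner_sub_right x] at hin
  nlinarith

lemma expDual_perturb_bounds {E : Rn n → ℝ≥0∞} {ζ : Rn n → ℝ} {M : ℝ} (hM : ∀ x, |ζ x| ≤ M)
    {t : ℝ} (ht : 0 ≤ t) (y : Rn n) :
    expDual E y * eexp (-(t * M)) ≤ expDual (fun x => E x * eexp (t * ζ x)) y ∧
      expDual (fun x => E x * eexp (t * ζ x)) y ≤ expDual E y * eexp (t * M) := by
  constructor
  · rw [mul_comm, ← expDual_const_mul]
    refine expDual_mono (fun x => ?_) y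
    rw [mul_comm]
    refine mul_le_mul' le_rfl (eexp_mono ?_)
    nlinarith [neg_le_of_abs_le (hM x)]
  · rw [mul_comm, ← expDual_const_mul]
    refine expDual_mono (fun x => ?_) y
    rw [mul_comm]
    refine mul_le_mul' (eexp_mono ?_) le_rfl
    nlinarith [le_of_abs_le (hM x)]

/-- Envelope theorem: at points of differentiability the logarithmic derivative of the perturbed
transform is `ζ (∇φ)`. -/
lemma expDual_perturb_near {f : Rn n → ℝ≥0} {E : Rn n → ℝ≥0∞}
    (hfE : ∀ y, (f y : ℝ≥0∞) = expDual E y) {y p : Rn n} (hy : ∀ᶠ z in 𝓝 y, f z ≠ 0)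
    (hp : HasGradientAt (fun x => (negLog f x).toReal) p y) {ζ : Rn n → ℝ} (hζ : Continuous ζ)
    {M : ℝ} (hM : ∀ x, |ζ x| ≤ M) {ε : ℝ} (hε : 0 < ε) :
    ∀ᶠ t in 𝓝[>] (0 : ℝ),
      f y * eexp (t * (ζ p - ε)) ≤ expDual (fun x => E x * eexp (t * ζ x)) y ∧
        expDual (fun x => E x * eexp (t * ζ x)) y ≤ f y * eexp (t * (ζ p + ε)) := by
  obtain ⟨η, hη, hηζ⟩ := Metric.continuousAt_iff.1 (hζ.continuousAt (x := p)) (ε / 2)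
    (by linarith)
  obtain ⟨δ, hδ, hclose⟩ := near_minimizers_close hfE hy hp hη
  have hfy : f y ≠ 0 := hy.self_of_nhds
  have hζx : ∀ x, E x * eexp (-(inner ℝ x y)) ≤ f y * eexp δ → |ζ x - ζ p| < ε / 2 := fun x hx =>
    hηζ (by simpa [dist_eq_norm] using hclose x hx)
  have hM0 : 0 ≤ M := (abs_nonneg _).trans (hM 0)
  -- For such `t` the slack `δ` at points that are not near-minimizers outweighs the change in `tζ`,
  -- so only `x` near `p` matter.
  have ht1 : ∀ᶠ t in 𝓝[>] (0 : ℝ), t * (2 * M + ε) < δ := by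
    have : Tendsto (fun t : ℝ => t * (2 * M + ε)) (𝓝[>] 0) (𝓝 (0 * (2 * M + ε))) :=
      (tendsto_id.mono_left nhdsWithin_le_nhds).mul_const _
    rw [zero_mul] at this
    exact this.eventually (gt_mem_nhds hδ)
  filter_upwards [ht1, self_mem_nhdsWithin] with t htδ ht0
  have ht0 : 0 < t := ht0
  constructor
  · refine le_iInf fun x => ?_
    have hfx : (f y : ℝ≥0∞) ≤ E x * eexp (-(inner ℝ x y)) := hfE y ▸ expDual_le E x y
    rw [mul_assoc, mul_comm (eexp _), ← mul_assoc]
    rcases le_or_gt (E x * eexp (-(inner ℝ x y))) (f y * eexp δ) with h | h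
    · refine mul_le_mul' hfx (eexp_mono ?_)
      have := abs_lt.1 (hζx x h)
      nlinarith
    · calc (f y : ℝ≥0∞) * eexp (t * (ζ p - ε)) ≤ f y * (eexp δ * eexp (t * ζ x)) := by
            refine mul_le_mul' le_rfl ?_
            rw [← eexp_add]
            refine eexp_mono ?_
            have h1 := le_of_abs_le (hM p)
            have h2 := neg_le_of_abs_le (hM x)
            nlinarith
        _ = f y * eexp δ * eexp (t * ζ x) := by ring
        _ ≤ _ := mul_le_mul' h.le le_rfl
  -- For the upper bound a single near-minimizer with slack `tε / 2` is enough.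
  · have hlt : expDual E y < f y * eexp (t * (ε / 2)) := by
      rw [← hfE, coe_eq_eexp hfy, ← eexp_add, eexp_lt_eexp_iff]
      have : 0 < t * (ε / 2) := by positivity
      linarith
    obtain ⟨x, hx⟩ := iInf_lt_iff.1 hlt
    have h1 := abs_lt.1 (hζx x (hx.le.trans (mul_le_mul' le_rfl (eexp_mono (by nlinarith)))))
    calc expDual (fun x => E x * eexp (t * ζ x)) y
        ≤ E x * eexp (t * ζ x) * eexp (-(inner ℝ x y)) := expDual_le _ x y
      _ = E x * eexp (-(inner ℝ x y)) * eexp (t * ζ x) := by ring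
      _ ≤ f y * eexp (t * (ε / 2)) * eexp (t * ζ x) := mul_le_mul' hx.le le_rfl
      _ = f y * eexp (t * (ε / 2) + t * ζ x) := by rw [mul_assoc, eexp_add]
      _ ≤ f y * eexp (t * (ζ p + ε)) := by
          refine mul_le_mul' le_rfl (eexp_mono ?_)
          nlinarith

/-- The difference quotient of `t ↦ log (expDual (E e^{tζ}))` at `0`. -/
def logQuotient (E : Rn n → ℝ≥0∞) (ζ : Rn n → ℝ) (t : ℝ) (y : Rn n) : ℝ :=
  (Real.log (expDual (fun x => E x * eexp (t * ζ x)) y).toReal -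
    Real.log (expDual E y).toReal) / t

lemma measurable_logQuotient (E : Rn n → ℝ≥0∞) (ζ : Rn n → ℝ) (t : ℝ) :
    Measurable (logQuotient E ζ t) :=
  ((Real.measurable_log.comp (measurable_expDual _).ennreal_toReal).sub
    (Real.measurable_log.comp (measurable_expDual _).ennreal_toReal)).div_const t

lemma toReal_eexp (r : ℝ) : (eexp r).toReal = Real.exp r :=
  ENNReal.toReal_ofReal (Real.exp_pos r).le

lemma expDual_perturb_eq {E : Rn n → ℝ≥0∞} {ζ : Rn n → ℝ} {M : ℝ} (hM : ∀ x, |ζ x| ≤ M)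
    {t : ℝ} (ht : 0 < t) {y : Rn n} (h0 : expDual E y ≠ 0) (h1 : expDual E y ≠ ∞) :
    expDual (fun x => E x * eexp (t * ζ x)) y = expDual E y * eexp (t * logQuotient E ζ t y) := by
  obtain ⟨hl, hu⟩ := expDual_perturb_bounds (E := E) hM ht.le y
  obtain ⟨a, ha⟩ := exists_eq_eexp h0 h1
  obtain ⟨b, hb⟩ := exists_eq_eexp (a := expDual (fun x => E x * eexp (t * ζ x)) y)
    (fun h => by
      rw [h, nonpos_iff_eq_zero, mul_eq_zero] at hl
      exact hl.elim h0 (eexp_ne_zero _))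
    (ne_top_of_le_ne_top (ENNReal.mul_ne_top h1 (eexp_ne_top _)) hu)
  rw [logQuotient, hb, ha, toReal_eexp, toReal_eexp, Real.log_exp, Real.log_exp, ← eexp_add,
    mul_div_cancel₀ _ ht.ne', add_sub_cancel]

lemma abs_logQuotient_le {E : Rn n → ℝ≥0∞} {ζ : Rn n → ℝ} {M : ℝ} (hM : ∀ x, |ζ x| ≤ M)
    {t : ℝ} (ht : 0 < t) {y : Rn n} (h0 : expDual E y ≠ 0) (h1 : expDual E y ≠ ∞) :
    |logQuotient E ζ t y| ≤ M := by
  obtain ⟨hl, hu⟩ := expDual_perturb_bounds (E := E) hM ht.le y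
  rw [expDual_perturb_eq hM ht h0 h1] at hl hu
  rw [ENNReal.mul_le_mul_iff_right h0 h1, eexp_le_eexp_iff] at hl hu
  exact abs_le.2 ⟨by nlinarith, by nlinarith⟩

lemma tendsto_logQuotient {f : Rn n → ℝ≥0} {E : Rn n → ℝ≥0∞}
    (hfE : ∀ y, (f y : ℝ≥0∞) = expDual E y) {y p : Rn n} (hy : ∀ᶠ z in 𝓝 y, f z ≠ 0)
    (hp : HasGradientAt (fun x => (negLog f x).toReal) p y) {ζ : Rn n → ℝ} (hζ : Continuous ζ)
    {M : ℝ} (hM : ∀ x, |ζ x| ≤ M) :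
    Tendsto (fun t => logQuotient E ζ t y) (𝓝[>] 0) (𝓝 (ζ p)) := by
  have h0 : expDual E y ≠ 0 := hfE y ▸ ENNReal.coe_ne_zero.2 hy.self_of_nhds
  have h1 : expDual E y ≠ ∞ := hfE y ▸ ENNReal.coe_ne_top
  refine Metric.tendsto_nhds.2 fun ε hε => ?_
  filter_upwards [expDual_perturb_near hfE hy hp hζ hM (half_pos hε), self_mem_nhdsWithin]
    with t ht ht0
  have ht0 : 0 < t := ht0
  rw [hfE, expDual_perturb_eq hM ht0 h0 h1, ENNReal.mul_le_mul_iff_right h0 h1,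
    ENNReal.mul_le_mul_iff_right h0 h1, eexp_le_eexp_iff, eexp_le_eexp_iff,
    mul_le_mul_iff_right₀ ht0, mul_le_mul_iff_right₀ ht0] at ht
  rw [Real.dist_eq]
  exact abs_lt.2 ⟨by linarith [ht.1], by linarith [ht.2]⟩

/-! ### The energy density as a measure on pairs of points -/

/-- The measure `f(x) f(y) |x - y|^{-(n-α)} dx dy`. -/
def pairMeasure (α : ℝ) (f : Rn n → ℝ≥0) : Measure (Rn n × Rn n) :=
  volume.withDensity fun p => f p.1 * f p.2 * rieszKernel α (p.1 - p.2)

/-- The measure `I_α(f, y) f(y) dy`. -/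
def potentialMeasure (α : ℝ) (f : Rn n → ℝ≥0) : Measure (Rn n) :=
  volume.withDensity fun y => rieszPotential α f y * f y

lemma pairMeasure_univ (α : ℝ) (f : Rn n → ℝ≥0) :
    pairMeasure α f univ = energy α fun x => (f x : ℝ≥0∞) := by
  rw [pairMeasure, withDensity_apply _ MeasurableSet.univ, Measure.restrict_univ, energy]

lemma measurable_rieszPotential (α : ℝ) {f : Rn n → ℝ≥0} (hf : Measurable f) :
    Measurable (rieszPotential α f) := by
  unfold rieszPotential
  refine Measurable.lintegral_prod_left' (f := fun p : Rn n × Rn n =>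
    (f p.1 : ℝ≥0∞) / ‖p.1 - p.2‖ₑ ^ ((n : ℝ) - α)) ?_
  fun_prop

lemma measurable_potential_density (α : ℝ) {f : Rn n → ℝ≥0} (hf : Measurable f) :
    Measurable fun y => rieszPotential α f y * f y :=
  (measurable_rieszPotential α hf).mul hf.coe_nnreal_ennreal

lemma map_snd_pairMeasure (α : ℝ) {f : Rn n → ℝ≥0} (hf : Measurable f) :
    (pairMeasure α f).map Prod.snd = potentialMeasure α f := by
  have hm := measurable_energy_integrand α hf.coe_nnreal_ennreal
  ext s hs
  rw [Measure.map_apply measurable_snd hs, pairMeasure, withDensity_apply _ (measurable_snd hs),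
    potentialMeasure, withDensity_apply _ hs, ← lintegral_indicator (measurable_snd hs),
    ← lintegral_indicator hs, Measure.volume_eq_prod,
    lintegral_prod_symm _ (hm.indicator (measurable_snd hs)).aemeasurable]
  refine lintegral_congr fun y => ?_
  by_cases hy : y ∈ s
  · simp only [indicator, mem_preimage, hy, if_true]
    have hm : Measurable fun x : Rn n => (f x : ℝ≥0∞) / ‖x - y‖ₑ ^ ((n : ℝ) - α) := by fun_prop
    rw [rieszPotential, ← lintegral_mul_const _ hm]
    refine lintegral_congr fun x => ?_
    rw [rieszKernel, div_eq_mul_inv]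
    ring
  · simp [indicator, hy]

lemma map_swap_pairMeasure (α : ℝ) {f : Rn n → ℝ≥0} (hf : Measurable f) :
    (pairMeasure α f).map Prod.swap = pairMeasure α f := by
  have hm := measurable_energy_integrand α hf.coe_nnreal_ennreal
  have hsw : MeasurePreserving (Prod.swap : Rn n × Rn n → Rn n × Rn n) :=
    Measure.measurePreserving_swap
  ext s hs
  rw [Measure.map_apply measurable_swap hs, pairMeasure, withDensity_apply _ (measurable_swap hs),
    withDensity_apply _ hs, ← hsw.setLIntegral_comp_preimage hs hm]
  refine lintegral_congr fun p => ?_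
  rw [← rieszKernel_neg, neg_sub, mul_comm (f p.1 : ℝ≥0∞)]
  rfl

lemma map_fst_pairMeasure (α : ℝ) {f : Rn n → ℝ≥0} (hf : Measurable f) :
    (pairMeasure α f).map Prod.fst = potentialMeasure α f := by
  rw [← map_snd_pairMeasure α hf]
  conv_rhs => rw [← map_swap_pairMeasure α hf, Measure.map_map measurable_snd measurable_swap]
  rfl

/-- The density carries the factor `f y`, so the measure already lives on `K_f` and the restriction
changes nothing. -/
lemma rieszEnergyMeasure_eq_map (α : ℝ) {f : Rn n → ℝ≥0} (hf : Measurable f) :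
    rieszEnergyMeasure α f = (potentialMeasure α f).map (gradNegLog f) := by
  rw [rieszEnergyMeasure, closedSupport, potentialMeasure, ← restrict_withDensity isClosed_closure.measurableSet,
    Measure.restrict_eq_self_of_ae_mem]
  rw [ae_withDensity_iff (measurable_potential_density α hf)]
  refine ae_of_all _ fun y hy => subset_closure ?_
  intro h
  simp [h] at hy

/-- The chain rule for a linear isomorphism needs no differentiability, so the identity also covers
points where the gradient takes its default value. -/
lemma gradNegLog_neg {f : Rn n → ℝ≥0} (hf : ∀ y, f (-y) = f y) (y : Rn n) :
    gradNegLog f (-y) = -gradNegLog f y := by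
  have h := (ContinuousLinearEquiv.neg ℝ (M := Rn n)).comp_right_fderiv
    (f := fun x => (negLog f x).toReal) (x := -y)
  have h1 : (fun x => (negLog f x).toReal) ∘ (ContinuousLinearEquiv.neg ℝ (M := Rn n)) =
      fun x => (negLog f x).toReal := by
    ext x
    simp [negLog, hf]
  rw [h1] at h
  rw [gradNegLog, gradNegLog, gradient, gradient, h, ← map_neg]
  congr 1
  ext v
  simp

lemma map_neg_potentialMeasure (α : ℝ) {f : Rn n → ℝ≥0} (hfm : Measurable f)
    (hf : ∀ y, f (-y) = f y) :
    (potentialMeasure α f).map (fun y => -y) = potentialMeasure α f := by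
  have hm : Measurable fun y => rieszPotential α f y * f y := measurable_potential_density α hfm
  have hneg : MeasurePreserving (fun y : Rn n => -y) := Measure.measurePreserving_neg _
  have hpot : ∀ y, rieszPotential α f (-y) = rieszPotential α f y := fun y => by
    rw [rieszPotential, rieszPotential, ← lintegral_neg_eq_self]
    refine lintegral_congr fun x => ?_
    rw [hf, ← neg_sub', enorm_neg]
  ext s hs
  rw [Measure.map_apply measurable_neg hs, potentialMeasure, withDensity_apply _ (measurable_neg hs),
    withDensity_apply _ hs, ← hneg.setLIntegral_comp_preimage hs hm]
  refine lintegral_congr fun y => ?_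
  rw [hpot, hf]

/-! ### First variation of the energy; even test functions -/

lemma energy_perturb_eq_lintegral {α : ℝ} {f : Rn n → ℝ≥0} {E : Rn n → ℝ≥0∞}
    (hfE : ∀ y, (f y : ℝ≥0∞) = expDual E y) {ζ : Rn n → ℝ} {M : ℝ} (hM : ∀ x, |ζ x| ≤ M)
    {t : ℝ} (ht : 0 < t) :
    energy α (expDual fun x => E x * eexp (t * ζ x)) =
      ∫⁻ p, eexp (t * (logQuotient E ζ t p.1 + logQuotient E ζ t p.2)) ∂pairMeasure α f := by
  have hfm : Measurable fun y => (f y : ℝ≥0∞) := funext hfE ▸ measurable_expDual E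
  have hL := measurable_logQuotient E ζ t
  have hLm : Measurable fun p : Rn n × Rn n =>
      eexp (t * (logQuotient E ζ t p.1 + logQuotient E ζ t p.2)) :=
    continuous_eexp.measurable.comp
      (((hL.comp measurable_fst).add (hL.comp measurable_snd)).const_mul t)
  rw [pairMeasure, lintegral_withDensity_eq_lintegral_mul _ (measurable_energy_integrand α hfm) hLm,
    energy]
  have hpt : ∀ y, expDual (fun x => E x * eexp (t * ζ x)) y =
      f y * eexp (t * logQuotient E ζ t y) := fun y => by
    rcases eq_or_ne (f y) 0 with h | h
    -- Where `f` vanishes so does the perturbed transform, and the default value of `logQuotient` is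
    -- irrelevant.
    · have h1 := (expDual_perturb_bounds (E := E) hM ht.le y).2
      rw [← hfE, h] at h1
      simpa [h] using h1
    · rw [hfE, expDual_perturb_eq hM ht (hfE y ▸ ENNReal.coe_ne_zero.2 h)
        (hfE y ▸ ENNReal.coe_ne_top)]
  refine lintegral_congr fun p => ?_
  simp only [Pi.mul_apply, hpt, mul_add, eexp_add]
  ring

/-- The variational inequality for all small perturbations bounds the integral of the test
function against the push-forward of the energy density. -/
lemma integral_comp_gradNegLog_le {α : ℝ} {f : Rn n → ℝ≥0} {E : Rn n → ℝ≥0∞}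
    (hfE : ∀ y, (f y : ℝ≥0∞) = expDual E y) {m : ℝ} (hm : 0 ≤ m)
    (hen : energy α (expDual E) = ENNReal.ofReal m) {ζ : Rn n → ℝ} (hζ : Continuous ζ) {M : ℝ}
    (hM : ∀ x, |ζ x| ≤ M) {b : ℝ}
    (hvar : ∀ t > 0, energy α (expDual fun x => E x * eexp (t * ζ x)) ≤
      ENNReal.ofReal m * eexp (2 * (t * b))) :
    ∫ y, ζ (gradNegLog f y) ∂potentialMeasure α f ≤ m * b := by
  have hfm' : Measurable fun y => (f y : ℝ≥0∞) := funext hfE ▸ measurable_expDual E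
  have hfm : Measurable f := by simpa using hfm'.ennreal_toNNReal
  set Q := pairMeasure α f with hQ
  have hQuniv : Q univ = ENNReal.ofReal m := by
    rw [hQ, pairMeasure_univ, ← hen]
    exact congrArg _ (funext hfE)
  have : IsFiniteMeasure Q := ⟨hQuniv ▸ ENNReal.ofReal_lt_top⟩
  have hgood : ∀ᵐ y ∂potentialMeasure α f, f y ≠ 0 ∧ (∀ᶠ z in 𝓝 y, f z ≠ 0) ∧
      HasGradientAt (fun x => (negLog f x).toReal) (gradNegLog f y) y := by
    rw [potentialMeasure,
      ae_withDensity_iff (measurable_potential_density α hfm)]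
    filter_upwards [ae_differentiableAt_negLog hfE] with y hy h0
    have hy0 : f y ≠ 0 := fun h => by simp [h] at h0
    exact ⟨hy0, hy hy0⟩
  have hgood1 := ae_of_ae_map measurable_fst.aemeasurable ((map_fst_pairMeasure α hfm).symm ▸ hgood)
  have hgood2 := ae_of_ae_map measurable_snd.aemeasurable ((map_snd_pairMeasure α hfm).symm ▸ hgood)
  have hbound : ∀ t > 0, ∀ᵐ p ∂Q,
      ‖logQuotient E ζ t p.1 + logQuotient E ζ t p.2‖ ≤ 2 * M := fun t ht => by
    filter_upwards [hgood1, hgood2] with p h1 h2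
    have h1' := abs_logQuotient_le hM ht (hfE p.1 ▸ ENNReal.coe_ne_zero.2 h1.1)
      (hfE p.1 ▸ ENNReal.coe_ne_top)
    have h2' := abs_logQuotient_le hM ht (hfE p.2 ▸ ENNReal.coe_ne_zero.2 h2.1)
      (hfE p.2 ▸ ENNReal.coe_ne_top)
    rw [Real.norm_eq_abs]
    exact (abs_add_le _ _).trans (by linarith)
  have hmeas : ∀ t, Measurable fun p : Rn n × Rn n =>
      logQuotient E ζ t p.1 + logQuotient E ζ t p.2 := fun t =>
    ((measurable_logQuotient E ζ t).comp measurable_fst).add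
      ((measurable_logQuotient E ζ t).comp measurable_snd)
  have hint : ∀ t > 0, Integrable (fun p : Rn n × Rn n =>
      logQuotient E ζ t p.1 + logQuotient E ζ t p.2) Q := fun t ht =>
    (integrable_const (2 * M)).mono' (hmeas t).aestronglyMeasurable (hbound t ht)
  have hineq : ∀ t > 0, ∫ p, (logQuotient E ζ t p.1 + logQuotient E ζ t p.2) ∂Q ≤
      t⁻¹ * (m * Real.exp (2 * (t * b)) - m) := fun t ht => by
    have h1 := hvar t ht
    rw [energy_perturb_eq_lintegral hfE hM ht, eexp, ← ENNReal.ofReal_mul hm] at h1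
    -- The inequality `e^u ≥ 1 + u` linearizes the energy from below, so only the difference
    -- quotients, bounded by `2 * M`, have to converge.
    have hint1 : Integrable (fun p : Rn n × Rn n =>
        t * (logQuotient E ζ t p.1 + logQuotient E ζ t p.2) + 1) Q :=
      ((hint t ht).const_mul t).add (integrable_const 1)
    have h2 := ((ofReal_integral_le_lintegral hint1).trans (lintegral_mono fun p =>
      ENNReal.ofReal_le_ofReal (Real.add_one_le_exp _))).trans h1
    rw [ENNReal.ofReal_le_ofReal_iff (by positivity),
      integral_add ((hint t ht).const_mul t) (integrable_const 1), integral_const_mul] at h2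
    simp only [integral_const, measureReal_def, hQuniv, ENNReal.toReal_ofReal hm, smul_eq_mul,
      mul_one] at h2
    rw [le_inv_mul_iff₀ ht]
    linarith
  have hτ : Tendsto (fun k : ℕ => 1 / ((k : ℝ) + 1)) atTop (𝓝[>] 0) :=
    tendsto_nhdsWithin_iff.2 ⟨tendsto_one_div_add_atTop_nhds_zero_nat,
      Eventually.of_forall fun k => mem_Ioi.2 Nat.one_div_pos_of_nat⟩
  have hlim : Tendsto (fun k : ℕ => ∫ p, (logQuotient E ζ (1 / ((k : ℝ) + 1)) p.1 +
      logQuotient E ζ (1 / ((k : ℝ) + 1)) p.2) ∂Q) atTop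
      (𝓝 (∫ p, (ζ (gradNegLog f p.1) + ζ (gradNegLog f p.2)) ∂Q)) := by
    refine tendsto_integral_of_dominated_convergence (fun _ => 2 * M)
      (fun k => (hmeas _).aestronglyMeasurable) (integrable_const _)
      (fun k => hbound _ Nat.one_div_pos_of_nat) ?_
    filter_upwards [hgood1, hgood2] with p h1 h2
    exact ((tendsto_logQuotient hfE h1.2.1 h1.2.2 hζ hM).comp hτ).add
      ((tendsto_logQuotient hfE h2.2.1 h2.2.2 hζ hM).comp hτ)
  have hrhs : Tendsto (fun t : ℝ => t⁻¹ * (m * Real.exp (2 * (t * b)) - m)) (𝓝[>] 0)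
      (𝓝 (m * (2 * b))) := by
    have hd : HasDerivAt (fun t : ℝ => m * Real.exp (2 * (t * b))) (m * (2 * b)) 0 := by
      have h1 : HasDerivAt (fun t : ℝ => 2 * (t * b)) (2 * b) 0 := by
        simpa using ((hasDerivAt_id (0 : ℝ)).mul_const b).const_mul 2
      simpa using h1.exp.const_mul m
    simpa using hd.tendsto_slope_zero_right
  have hle := le_of_tendsto_of_tendsto' hlim (hrhs.comp hτ)
    fun k => hineq _ Nat.one_div_pos_of_nat
  have hζG : Measurable fun y => ζ (gradNegLog f y) :=
    hζ.measurable.comp (measurable_gradNegLog f)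
  have hi : ∀ π : Rn n × Rn n → Rn n, Measurable π →
      Integrable (fun p => ζ (gradNegLog f (π p))) Q := fun π hπ =>
    (integrable_const M).mono' (hζG.comp hπ).aestronglyMeasurable
      (ae_of_all _ fun p => by simpa using hM _)
  -- Both marginals of `Q` are the potential measure, so the limit reads `2 ∫ ζ(∇φ) ≤ 2 m b`.
  rw [integral_add (hi _ measurable_fst) (hi _ measurable_snd),
    ← integral_map (f := fun y => ζ (gradNegLog f y)) measurable_fst.aemeasurable
      hζG.aestronglyMeasurable,
    ← integral_map (f := fun y => ζ (gradNegLog f y)) measurable_snd.aemeasurable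
      hζG.aestronglyMeasurable, hQ, map_fst_pairMeasure α hfm, map_snd_pairMeasure α hfm] at hle
  linarith

/-- Even finite measures agree as soon as they agree on even bounded continuous functions. -/
lemma measure_ext_of_even {μ ν : Measure (Rn n)} [IsFiniteMeasure μ] [IsFiniteMeasure ν]
    (hμ : μ.map (fun x => -x) = μ) (hν : ν.map (fun x => -x) = ν)
    (h : ∀ ζ : Rn n → ℝ, Continuous ζ → (∀ x, ζ (-x) = ζ x) → (∃ M, ∀ x, |ζ x| ≤ M) →
      ∫ x, ζ x ∂μ = ∫ x, ζ x ∂ν) : μ = ν := by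
  refine ext_of_forall_integral_eq_of_IsFiniteMeasure fun ζ => ?_
  have key : ∀ ρ : Measure (Rn n), IsFiniteMeasure ρ → ρ.map (fun x => -x) = ρ →
      ∫ x, (ζ x + ζ (-x)) ∂ρ = 2 * ∫ x, ζ x ∂ρ := by
    intro ρ _ hρ
    have h1 : Integrable (fun x => ζ (-x)) ρ :=
      (ζ.compContinuous ⟨fun x => -x, continuous_neg⟩).integrable ρ
    have h2 : ∫ x, ζ (-x) ∂ρ = ∫ x, ζ x ∂ρ := by
      conv_rhs => rw [← hρ]
      rw [integral_map measurable_neg.aemeasurable ζ.continuous.aestronglyMeasurable]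
    rw [integral_add (ζ.integrable ρ) h1, h2]
    ring
  -- Symmetrizing a test function only doubles its integral against an even measure.
  have h1 := h (fun x => ζ x + ζ (-x)) (by fun_prop) (fun x => by rw [neg_neg, add_comm])
    ⟨‖ζ‖ + ‖ζ‖, fun x => (abs_add_le _ _).trans
      (add_le_add (ζ.norm_coe_le_norm x) (ζ.norm_coe_le_norm (-x)))⟩
  rw [key μ inferInstance hμ, key ν inferInstance hν] at h1
  linarith

end RieszEnergy

end


/-! ### Normalization and conclusion -/

theorem theorem1p5 (n : ℕ) (hn : 1 ≤ n) (α : ℝ) (hα : 0 < α)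
    (μ : MeasureTheory.Measure (RieszEnergy.Rn n)) (hfin : MeasureTheory.IsFiniteMeasure μ)
    (hne : μ ≠ 0)
    (heven : ∀ A : Set (RieszEnergy.Rn n), MeasurableSet A → μ ((fun x => -x) ⁻¹' A) = μ A)
    (hsub : ∀ L : Submodule ℝ (RieszEnergy.Rn n), L ≠ ⊤ → μ (L : Set (RieszEnergy.Rn n))ᶜ ≠ 0)
    (hmom : MeasureTheory.Integrable (fun x : RieszEnergy.Rn n => ‖x‖) μ) :
    ∃ f : RieszEnergy.Rn n → ℝ≥0, RieszEnergy.MemLC f ∧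
      RieszEnergy.rieszEnergy α f = μ Set.univ ∧
      μ = RieszEnergy.rieszEnergyMeasure α f := by
  have : NeZero n := ⟨by omega⟩
  have : Nontrivial (RieszEnergy.Rn n) := inferInstance
  set m := μ Set.univ with hm
  have hm0 : m ≠ 0 := by simpa [hm] using hne
  have hmtop : m ≠ ∞ := MeasureTheory.measure_ne_top μ _
  set P := m⁻¹ • μ with hP
  have hμP : μ = m • P := by
    rw [hP, smul_smul, ENNReal.mul_inv_cancel hm0 hmtop, one_smul]
  have : MeasureTheory.IsProbabilityMeasure P := ⟨by
    rw [hP, Measure.smul_apply, smul_eq_mul, ← hm, ENNReal.inv_mul_cancel hm0 hmtop]⟩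
  have hminv : m⁻¹ ≠ ∞ := ENNReal.inv_ne_top.2 hm0
  obtain ⟨E, hE, hen, ⟨b, c, hc, hdecay⟩, hvar⟩ := RieszEnergy.exists_extremal hα P
    (hmom.smul_measure hminv)
    (fun L hL => by
      rw [hP, Measure.smul_apply, smul_eq_mul]
      exact mul_ne_zero (ENNReal.inv_ne_zero.2 hmtop) (hsub L hL)) hm0 hmtop
  have hEtop : ∀ y, RieszEnergy.expDual E y ≠ ∞ := fun y => ne_top_of_le_ne_top
    (ENNReal.mul_ne_top (RieszEnergy.eexp_ne_top _) ENNReal.ofReal_ne_top) (hdecay y)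
  set f : RieszEnergy.Rn n → ℝ≥0 := fun y => (RieszEnergy.expDual E y).toNNReal with hf
  have hfE : ∀ y, (f y : ℝ≥0∞) = RieszEnergy.expDual E y := fun y => ENNReal.coe_toNNReal (hEtop y)
  have hfm : Measurable f := (RieszEnergy.measurable_expDual E).ennreal_toNNReal
  have hfeven : ∀ y, f (-y) = f y := fun y => by simp only [hf, RieszEnergy.expDual_neg hE]
  have hfen : RieszEnergy.rieszEnergy α f = m := by
    rw [RieszEnergy.rieszEnergy_eq_energy α hfm, funext hfE, hen]
  refine ⟨f, ⟨RieszEnergy.logConcave_of_coe_eq_expDual hfE, ?_, ?_, ?_⟩, hfen, ?_⟩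
  · intro y a ha
    have ha' : RieszEnergy.expDual E y < a := hfE y ▸ ENNReal.coe_lt_coe.2 ha
    filter_upwards [RieszEnergy.upperSemicontinuous_expDual E y a ha'] with z hz
    exact ENNReal.coe_lt_coe.1 (hfE z ▸ hz)
  -- If `f` vanished almost everywhere, its energy would be `0` rather than `m`.
  · refine pos_iff_ne_zero.2 fun h0 => hm0 ?_
    rw [← hfen]
    have hae := (MeasureTheory.lintegral_eq_zero_iff hfm.coe_nnreal_ennreal).1 h0
    rw [RieszEnergy.rieszEnergy, MeasureTheory.lintegral_eq_zero_iff
      (RieszEnergy.measurable_potential_density α hfm)]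
    filter_upwards [hae] with y hy
    exact mul_eq_zero_of_right _ hy
  · simp only [hfE]
    refine (MeasureTheory.lintegral_mono hdecay).trans_lt ?_
    rw [MeasureTheory.lintegral_const_mul _ (RieszEnergy.measurable_expNegNorm c)]
    exact ENNReal.mul_lt_top (RieszEnergy.eexp_ne_top b).lt_top
      (RieszEnergy.lintegral_expNegNorm hc)
  · rw [RieszEnergy.rieszEnergyMeasure_eq_map α hfm]
    set ν := RieszEnergy.potentialMeasure α f with hν
    have hνuniv : ν Set.univ = m := by
      rw [← hfen, hν, RieszEnergy.potentialMeasure,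
        MeasureTheory.withDensity_apply _ MeasurableSet.univ, Measure.restrict_univ]
      rfl
    have : MeasureTheory.IsFiniteMeasure ν := ⟨hνuniv ▸ hmtop.lt_top⟩
    have hG := RieszEnergy.measurable_gradNegLog f
    refine RieszEnergy.measure_ext_of_even ?_ ?_ ?_
    · ext A hA
      rw [Measure.map_apply measurable_neg hA, heven A hA]
    · rw [Measure.map_map measurable_neg hG]
      conv_rhs => rw [hν, ← RieszEnergy.map_neg_potentialMeasure α hfm hfeven,
        Measure.map_map hG measurable_neg]
      congr 1
      ext1 y
      exact (RieszEnergy.gradNegLog_neg hfeven y).symm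
    · have hle : ∀ ζ : RieszEnergy.Rn n → ℝ, Continuous ζ → (∀ x, ζ (-x) = ζ x) →
          (∃ M, ∀ x, |ζ x| ≤ M) →
          ∫ y, ζ (RieszEnergy.gradNegLog f y) ∂ν ≤ m.toReal * ∫ x, ζ x ∂P := by
        rintro ζ hζ hζe ⟨M, hM⟩
        refine RieszEnergy.integral_comp_gradNegLog_le hfE ENNReal.toReal_nonneg
          (by rw [hen, ENNReal.ofReal_toReal hmtop]) hζ hM fun t ht => ?_
        have h := hvar (fun x => t * ζ x) (by fun_prop) (fun x => by rw [hζe])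
          ⟨t * M, fun x => by
            rw [abs_mul, abs_of_pos ht]
            exact mul_le_mul_of_nonneg_left (hM x) ht.le⟩
        rwa [MeasureTheory.integral_const_mul, ← ENNReal.ofReal_toReal hmtop] at h
      rintro ζ hζ hζe ⟨M, hM⟩
      rw [MeasureTheory.integral_map hG.aemeasurable hζ.aestronglyMeasurable, hμP,
        MeasureTheory.integral_smul_measure, smul_eq_mul]
      -- Applying the inequality to `-ζ` supplies the reverse direction.
      refine le_antisymm ?_ (hle ζ hζ hζe ⟨M, hM⟩)
      have h := hle (fun x => -ζ x) hζ.neg (fun x => by rw [hζe]) ⟨M, fun x => by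
        rw [abs_neg]; exact hM x⟩
      rw [MeasureTheory.integral_neg, MeasureTheory.integral_neg] at h
      linarith
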